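/- Let $\ell>0$, let $S^1_\ell=\mathbb{R}/\ell\mathbb{Z}$ be the circle of length $\ell$ with arclength coordinate $s$, and let $\mu_1$ be the smallest positive eigenvalue of $-\frac{d^2}{ds^2}$ on $S^1_\ell$. Let $\kappa_0\in\mathbb{R}$, $\kappa_0\neq 0$, and let $$K=\Big\{\kappa\in C(S^1_\ell;\mathbb{R}) : \frac1\ell\int_{S^1_\ell}\kappa\,ds=\kappa_0\Big\}.$$ For $\alpha>0$ and continuous $\kappa : S^1_\ell\to\mathbb{R}$ the operator $H=-\frac{d^2}{ds^2}+\alpha\kappa^2$ on $S^1_\ell$ has a smallest eigenvalue, denoted $\lambda_0(\kappa)=\lambda_0(\alpha,\kappa)$. Put $\Lambda_0(\alpha)=\inf_{\kappa\in K}\lambda_0(\alpha,\kappa)$, and, with $F(x)=x^2$, $$\alpha^*=\frac{\mu_1F''(\kappa_0)}{2F'(\kappa_0)^2}=\frac{\mu_1}{4\kappa_0^2}.$$ Call $\alpha_c>0$ the critical value if the constant function $\kappa_0$ is a global minimizer of $\lambda_0(\alpha,\cdot)$ on $K$ for every $0<\alpha<\alpha_c$ and is not one for any $\alpha>\alpha_c$.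 Then: 1. the critical value exists, is unique, and equals $\alpha_c=\alpha^*$; moreover, for $0<\alpha<\alpha_c$ the constant $\kappa_0$ is the unique global minimizer: $\lambda_0(\alpha,\kappa_0)<\lambda_0(\alpha,\kappa)$ for every $\kappa\in K$ with $\kappa\not\equiv\kappa_0$; 2. for every $\alpha>\alpha_c$, $\Lambda_0(\alpha)=\mu_1/4$, and the infimum is not attained by any $\kappa\in K$. -/

import Mathlib

open MeasureTheory Set

noncomputable section

namespace CircleSchrodinger

/-- `lam` is an eigenvalue of `-d²/ds² + V` on the circle of length `ℓ` (with arclength coordinate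
`s`): there is a nonzero `C²` function `u` on the circle with `-u'' + V u = lam u`. -/
def IsEigenvalue (ℓ : ℝ) (V : C(AddCircle ℓ, ℝ)) (lam : ℝ) : Prop :=
  ∃ u : AddCircle ℓ → ℝ, u ≠ 0 ∧ ContDiff ℝ 2 (fun s : ℝ => u (s : AddCircle ℓ)) ∧
    ∀ s : ℝ, -iteratedDeriv 2 (fun t : ℝ => u (t : AddCircle ℓ)) s
      + V (s : AddCircle ℓ) * u (s : AddCircle ℓ) = lam * u (s : AddCircle ℓ)

/-- The positive eigenvalues of the Laplacian `-d²/ds²` on the circle of length `ℓ`. -/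
def positiveLaplaceEigenvalues (ℓ : ℝ) : Set ℝ :=
  {μ | 0 < μ ∧ IsEigenvalue ℓ 0 μ}

/-- The first nonzero eigenvalue `μ₁` of `-d²/ds²` on the circle of length `ℓ`. -/
def mu1 (ℓ : ℝ) : ℝ := sInf (positiveLaplaceEigenvalues ℓ)

/-- The potential `α F(κ)`. -/
def potential {ℓ : ℝ} (F : C(ℝ, ℝ)) (α : ℝ) (κ : C(AddCircle ℓ, ℝ)) : C(AddCircle ℓ, ℝ) :=
  α • F.comp κ

/-- The principal (lowest) eigenvalue `λ₀(κ)` of `-d²/ds² + α F(κ)`. -/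
def lambda0 {ℓ : ℝ} (F : C(ℝ, ℝ)) (α : ℝ) (κ : C(AddCircle ℓ, ℝ)) : ℝ :=
  sInf {lam | IsEigenvalue ℓ (potential F α κ) lam}

/-- The class `K` of continuous functions on the circle with average `κ₀`. -/
def K (ℓ : ℝ) [Fact (0 < ℓ)] (κ₀ : ℝ) : Set C(AddCircle ℓ, ℝ) :=
  {κ | (1 / ℓ) * ∫ x : AddCircle ℓ, κ x = κ₀}

/-- `Λ₀(α)`, the infimum of `λ₀(κ)` over `κ ∈ K`. -/
def Lambda0 (ℓ : ℝ) [Fact (0 < ℓ)] (F : C(ℝ, ℝ)) (κ₀ α : ℝ) : ℝ :=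
  sInf (lambda0 F α '' K ℓ κ₀)

/-- The constant function `κ₀` is a global minimizer of `λ₀` over `K`. -/
def ConstIsMinimizer (ℓ : ℝ) [Fact (0 < ℓ)] (F : C(ℝ, ℝ)) (κ₀ α : ℝ) : Prop :=
  IsMinOn (lambda0 F α) (K ℓ κ₀) (ContinuousMap.const (AddCircle ℓ) κ₀)

/-- `αc` is the value of the parameter `α > 0` at which the constant function `κ₀` stops being a
global minimizer. -/
def IsCriticalValue (ℓ : ℝ) [Fact (0 < ℓ)] (F : C(ℝ, ℝ)) (κ₀ αc : ℝ) : Prop :=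
  0 < αc ∧ (∀ α, 0 < α → α < αc → ConstIsMinimizer ℓ F κ₀ α) ∧
    (∀ α, αc < α → ¬ ConstIsMinimizer ℓ F κ₀ α)

/-- `α* = μ₁ F''(κ₀) / (2 F'(κ₀)²)`. -/
def alphaStar (ℓ : ℝ) (F : C(ℝ, ℝ)) (κ₀ : ℝ) : ℝ :=
  mu1 ℓ * iteratedDeriv 2 F κ₀ / (2 * (deriv F κ₀) ^ 2)

/-- The function `F(κ) = κ²`. -/
def sqFun : C(ℝ, ℝ) := ⟨fun x => x ^ 2, by fun_prop⟩

end CircleSchrodinger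

end

noncomputable section

namespace CircleSchrodinger

open Filter Topology intervalIntegral

variable {ℓ : ℝ}

/-! Let `u` be the positive ground state for `κ`, and put N = ∫u², D = ∫u'², I = ∫u⁻². The energy
identity gives λ₀N = D + α∫κ²u². By Cauchy–Schwarz (`sq_integral_div_le`) the mean constraint forces
∫κ²u² ≥ (ℓκ₀)²/I, so κ disappears: λ₀N ≥ D + α(ℓκ₀)²/I. The sharp inequality `ermakov_inequality`,
(π/ℓ)²N ≤ D + π²/I, then decides everything. With θ = ακ₀²/(π/ℓ)² the last term is θπ²/I, and the
threshold is θ = 1, where π²/ℓ² = μ₁/4.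

If θ < 1, then λ₀N ≥ (1-θ)D + ακ₀²N, which is strict unless `u` is constant, a case that forces κ =
κ₀. If θ > 1, then λ₀ > π²/ℓ² strictly, so this value is never attained. It is approached by
concentrating κ near one point, where the test function sin(πs/ℓ) vanishes.

The ground state is built without spectral theory. Its logarithmic derivative `p` solves p' + p² = V
- lam. Solutions of nonnegative mean exist for very negative lam, and lam can be raised while the
mean stays positive. Arzelà–Ascoli compactness at the supremum yields mean zero, which is exactly
periodicity of exp ∫p (`exists_riccati_mean_zero`). The same `p`, through Jacobi's inequality, gives
the variational lower bound that makes lam the least eigenvalue. -/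

theorem continuous_coe_comp (g : C(AddCircle ℓ, ℝ)) : Continuous fun s : ℝ => g (s : AddCircle ℓ) :=
  g.continuous.comp (AddCircle.continuous_mk' ℓ)

theorem periodic_coe_comp {β : Type*} (g : AddCircle ℓ → β) :
    Function.Periodic (fun s : ℝ => g (s : AddCircle ℓ)) ℓ := fun s => by
  simp only [AddCircle.coe_add_period]

/-- A continuous `ℓ`-periodic function, as a continuous function on the circle of length `ℓ`. -/
def circleLift (f : ℝ → ℝ) (hf : Continuous f) (hp : Function.Periodic f ℓ) :
    C(AddCircle ℓ, ℝ) :=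
  ⟨hp.lift, (QuotientAddGroup.isQuotientMap_mk _).continuous_iff.2 hf⟩

@[simp]
theorem circleLift_coe (f : ℝ → ℝ) (hf : Continuous f) (hp : Function.Periodic f ℓ) (s : ℝ) :
    circleLift f hf hp (s : AddCircle ℓ) = f s := rfl

theorem exists_coe_Icc [hℓ : Fact (0 < ℓ)] (x : AddCircle ℓ) :
    ∃ s ∈ Icc (0 : ℝ) ℓ, (s : AddCircle ℓ) = x := by
  have h := AddCircle.coe_image_Icc_eq ℓ (0 : ℝ)
  rw [zero_add] at h
  have hx : x ∈ QuotientAddGroup.mk '' Icc (0 : ℝ) ℓ := h ▸ mem_univ x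
  exact hx

theorem abs_coe_le_norm [Fact (0 < ℓ)] (g : C(AddCircle ℓ, ℝ)) (s : ℝ) :
    |g (s : AddCircle ℓ)| ≤ ‖g‖ :=
  g.norm_coe_le_norm s

theorem norm_le_of_coe [Fact (0 < ℓ)] (g : C(AddCircle ℓ, ℝ)) {C : ℝ} (hC : 0 ≤ C)
    (h : ∀ s ∈ Icc (0 : ℝ) ℓ, |g (s : AddCircle ℓ)| ≤ C) : ‖g‖ ≤ C := by
  refine (ContinuousMap.norm_le g hC).2 fun x => ?_
  obtain ⟨s, hs, rfl⟩ := exists_coe_Icc x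
  exact h s hs

/-- The increment over a translate of `[0, s]` by a period. -/
theorem integral_add_period {f : ℝ → ℝ} (hf : Continuous f) (hp : Function.Periodic f ℓ) (s : ℝ) :
    ∫ t in (0 : ℝ)..s + ℓ, f t = (∫ t in (0 : ℝ)..s, f t) + ∫ t in (0 : ℝ)..ℓ, f t := by
  rw [← integral_add_adjacent_intervals (hf.intervalIntegrable 0 s) (hf.intervalIntegrable s _),
    hp.intervalIntegral_add_eq s 0, zero_add]

/-! ### Periodic solutions of first-order linear equations. -/

section LinearEquation

/-- The primitive of `2 p` vanishing at `0`. -/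
def intFactor (p : C(AddCircle ℓ, ℝ)) (s : ℝ) : ℝ := ∫ t in (0 : ℝ)..s, 2 * p (t : AddCircle ℓ)

theorem hasDerivAt_intFactor (p : C(AddCircle ℓ, ℝ)) (s : ℝ) :
    HasDerivAt (intFactor p) (2 * p (s : AddCircle ℓ)) s := by
  have hc : Continuous fun t : ℝ => 2 * p (t : AddCircle ℓ) :=
    continuous_const.mul (continuous_coe_comp p)
  exact integral_hasDerivAt_right (hc.intervalIntegrable _ _)
    hc.stronglyMeasurable.stronglyMeasurableAtFilter hc.continuousAt

theorem continuous_intFactor (p : C(AddCircle ℓ, ℝ)) : Continuous (intFactor p) :=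
  continuous_iff_continuousAt.2 fun s => (hasDerivAt_intFactor p s).continuousAt

theorem intFactor_add_period (p : C(AddCircle ℓ, ℝ)) (s : ℝ) :
    intFactor p (s + ℓ) = intFactor p s + intFactor p ℓ :=
  integral_add_period (continuous_const.mul (continuous_coe_comp p))
    (periodic_coe_comp fun x => 2 * p x) s

theorem continuous_exp_intFactor_mul (p f : C(AddCircle ℓ, ℝ)) :
    Continuous fun t : ℝ => Real.exp (intFactor p t) * f (t : AddCircle ℓ) :=
  (Real.continuous_exp.comp (continuous_intFactor p)).mul (continuous_coe_comp f)

/-- The primitive of `exp (∫ 2 p) f` vanishing at `0`. -/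
def weightedPrimitive (p f : C(AddCircle ℓ, ℝ)) (s : ℝ) : ℝ :=
  ∫ t in (0 : ℝ)..s, Real.exp (intFactor p t) * f (t : AddCircle ℓ)

theorem hasDerivAt_weightedPrimitive (p f : C(AddCircle ℓ, ℝ)) (s : ℝ) :
    HasDerivAt (weightedPrimitive p f) (Real.exp (intFactor p s) * f (s : AddCircle ℓ)) s := by
  have hc := continuous_exp_intFactor_mul p f
  exact integral_hasDerivAt_right (hc.intervalIntegrable _ _)
    hc.stronglyMeasurable.stronglyMeasurableAtFilter hc.continuousAt

theorem weightedPrimitive_add_period (p f : C(AddCircle ℓ, ℝ)) (s : ℝ) :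
    weightedPrimitive p f (s + ℓ)
      = weightedPrimitive p f ℓ + Real.exp (intFactor p ℓ) * weightedPrimitive p f s := by
  have hc := continuous_exp_intFactor_mul p f
  have h1 : weightedPrimitive p f (s + ℓ) = weightedPrimitive p f ℓ
      + ∫ t in ℓ..s + ℓ, Real.exp (intFactor p t) * f (t : AddCircle ℓ) :=
    (integral_add_adjacent_intervals (hc.intervalIntegrable _ _) (hc.intervalIntegrable _ _)).symm
  have h2 := integral_comp_add_right (a := 0) (b := s)
    (fun t => Real.exp (intFactor p t) * f (t : AddCircle ℓ)) ℓ
  rw [zero_add] at h2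
  rw [h1, ← h2]
  simp only [weightedPrimitive, ← intervalIntegral.integral_const_mul]
  congr 1
  refine integral_congr fun t _ => ?_
  simp only [intFactor_add_period, AddCircle.coe_add_period, Real.exp_add]
  ring

theorem weightedPrimitive_sub (p f g : C(AddCircle ℓ, ℝ)) (s : ℝ) :
    weightedPrimitive p (f - g) s = weightedPrimitive p f s - weightedPrimitive p g s := by
  simp only [weightedPrimitive]
  rw [← integral_sub ((continuous_exp_intFactor_mul p f).intervalIntegrable _ _)
    ((continuous_exp_intFactor_mul p g).intervalIntegrable _ _)]
  refine integral_congr fun t _ => ?_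
  simp only [ContinuousMap.sub_apply]
  ring

theorem abs_weightedPrimitive_le [Fact (0 < ℓ)] (p f : C(AddCircle ℓ, ℝ)) {s : ℝ} (hs : 0 ≤ s) :
    |weightedPrimitive p f s| ≤ ‖f‖ * weightedPrimitive p 1 s := by
  simp only [weightedPrimitive]
  rw [← intervalIntegral.integral_const_mul]
  refine (abs_integral_le_integral_abs hs).trans ?_
  refine integral_mono_on hs ((continuous_exp_intFactor_mul p f).abs.intervalIntegrable _ _)
    ((continuous_const.mul (continuous_exp_intFactor_mul p 1)).intervalIntegrable _ _) fun t _ => ?_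
  rw [abs_mul, abs_of_pos (Real.exp_pos _), ContinuousMap.one_apply, mul_one, mul_comm]
  exact mul_le_mul_of_nonneg_right (abs_coe_le_norm f t) (Real.exp_pos _).le

/-- The periodic solution of `q' + 2 p q = f`, where `p` has nonzero mean. -/
def linSol (p f : C(AddCircle ℓ, ℝ)) (s : ℝ) : ℝ :=
  Real.exp (-intFactor p s) *
    (weightedPrimitive p f ℓ / (Real.exp (intFactor p ℓ) - 1) + weightedPrimitive p f s)

theorem hasDerivAt_linSol (p f : C(AddCircle ℓ, ℝ)) (s : ℝ) :
    HasDerivAt (linSol p f) (f (s : AddCircle ℓ) - 2 * p (s : AddCircle ℓ) * linSol p f s) s := by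
  have h := ((hasDerivAt_intFactor p s).neg.exp).mul
    ((hasDerivAt_weightedPrimitive p f s).const_add
      (weightedPrimitive p f ℓ / (Real.exp (intFactor p ℓ) - 1)))
  refine h.congr_deriv ?_
  have he : Real.exp (-intFactor p s) * Real.exp (intFactor p s) = 1 := by
    rw [← Real.exp_add]; simp
  simp only [linSol, Pi.neg_apply]
  linear_combination f (s : AddCircle ℓ) * he

theorem continuous_linSol (p f : C(AddCircle ℓ, ℝ)) : Continuous (linSol p f) :=
  continuous_iff_continuousAt.2 fun s => (hasDerivAt_linSol p f s).continuousAt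

/-- The constant in `linSol` is the initial value c determined by c (exp (∫ 2p) - 1) = ∫ exp(∫ 2p) f
over one period. Positive mean of `p` makes the factor nonzero. -/
theorem periodic_linSol (p f : C(AddCircle ℓ, ℝ)) (hp : 0 < intFactor p ℓ) :
    Function.Periodic (linSol p f) ℓ := fun s => by
  have h1 : Real.exp (intFactor p ℓ) - 1 ≠ 0 := by
    have := Real.one_lt_exp_iff.2 hp
    linarith
  have h2 : Real.exp (-intFactor p (s + ℓ)) * Real.exp (intFactor p ℓ)
      = Real.exp (-intFactor p s) := by
    rw [← Real.exp_add, intFactor_add_period]; ring_nf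
  simp only [linSol]
  rw [weightedPrimitive_add_period, ← h2]
  field_simp
  ring

theorem linSol_sub (p f g : C(AddCircle ℓ, ℝ)) (s : ℝ) :
    linSol p (f - g) s = linSol p f s - linSol p g s := by
  simp only [linSol, weightedPrimitive_sub]
  ring

/-- For `p` of positive mean the solution operator is positive, so f can be compared with the
constant ‖f‖; its norm is thus controlled by its value on 1. -/
theorem abs_linSol_le [hℓ : Fact (0 < ℓ)] (p f : C(AddCircle ℓ, ℝ)) (hp : 0 < intFactor p ℓ) {s : ℝ}
    (hs : 0 ≤ s) : |linSol p f s| ≤ ‖f‖ * linSol p 1 s := by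
  have h1 : 0 < Real.exp (intFactor p ℓ) - 1 := by
    have := Real.one_lt_exp_iff.2 hp
    linarith
  simp only [linSol]
  rw [abs_mul, abs_of_pos (Real.exp_pos _), mul_left_comm]
  refine mul_le_mul_of_nonneg_left ((abs_add_le _ _).trans ?_) (Real.exp_pos _).le
  rw [mul_add, abs_div, abs_of_pos h1, ← mul_div_assoc]
  have := abs_weightedPrimitive_le p f hℓ.out.le
  have := abs_weightedPrimitive_le p f hs
  gcongr

end LinearEquation

/-! ### The Riccati equation and existence of the ground state. -/

/-- Small perturbations of the Riccati equation around a solution `p` of positive mean can be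
absorbed: if `q` solves `q' = f - 2 p q - q²`, then `(p + q)' + (p + q)² = p' + p² + f`. -/
theorem exists_riccati_correction [Fact (0 < ℓ)] (p f : C(AddCircle ℓ, ℝ))
    (hp : 0 < intFactor p ℓ) {B r : ℝ} (hr : 0 ≤ r)
    (hB : ∀ s ∈ Icc (0 : ℝ) ℓ, linSol p 1 s ≤ B) (h₁ : B * (‖f‖ + r ^ 2) ≤ r)
    (h₂ : 2 * B * r < 1) :
    ∃ q : C(AddCircle ℓ, ℝ), ‖q‖ ≤ r ∧ ∀ s : ℝ, HasDerivAt (fun t : ℝ => q (t : AddCircle ℓ))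
      (f (s : AddCircle ℓ) - 2 * p (s : AddCircle ℓ) * q (s : AddCircle ℓ)
        - q (s : AddCircle ℓ) ^ 2) s := by
  let S : C(AddCircle ℓ, ℝ) → C(AddCircle ℓ, ℝ) := fun g =>
    circleLift (linSol p g) (continuous_linSol p g) (periodic_linSol p g hp)
  have hℓ : (0 : ℝ) < ℓ := Fact.out
  have hB0 : 0 ≤ B := by
    have h := abs_linSol_le p 1 hp le_rfl
    have h' := hB 0 ⟨le_rfl, hℓ.le⟩
    rw [norm_one, one_mul] at h
    exact (abs_nonneg _).trans (h.trans h')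
  have hS : ∀ g, ‖S g‖ ≤ B * ‖g‖ := fun g => by
    refine norm_le_of_coe _ (by positivity) fun s hs => ?_
    have h := abs_linSol_le p g hp hs.1
    have h' := mul_le_mul_of_nonneg_left (hB s hs) (norm_nonneg g)
    simp only [S, circleLift_coe]
    linarith
  have hSsub : ∀ g k, S g - S k = S (g - k) := fun g k => by
    ext x
    obtain ⟨s, -, rfl⟩ := exists_coe_Icc x
    simp only [S, ContinuousMap.sub_apply, circleLift_coe, linSol_sub]
  -- A fixed point of Φ solves q' + 2pq = f - q². The bound `h₁` keeps the ball of radius r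
  -- invariant, and `h₂` makes Φ a contraction there.
  let Φ : C(AddCircle ℓ, ℝ) → C(AddCircle ℓ, ℝ) := fun q => S (f - q * q)
  have hmaps : MapsTo Φ (Metric.closedBall 0 r) (Metric.closedBall 0 r) := fun q hq => by
    rw [mem_closedBall_zero_iff] at hq ⊢
    refine (hS _).trans (le_trans (mul_le_mul_of_nonneg_left ?_ hB0) h₁)
    refine (norm_sub_le _ _).trans (add_le_add le_rfl ((norm_mul_le _ _).trans ?_))
    nlinarith [norm_nonneg q]
  have hcontr : ContractingWith (2 * B * r).toNNReal (hmaps.restrict Φ _ _) := by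
    refine ⟨by rw [Real.toNNReal_lt_one]; exact h₂, LipschitzWith.of_dist_le_mul fun a b => ?_⟩
    have ha := mem_closedBall_zero_iff.1 a.2
    have hb := mem_closedBall_zero_iff.1 b.2
    rw [Real.coe_toNNReal _ (by positivity), Subtype.dist_eq, Subtype.dist_eq]
    change dist (Φ a.1) (Φ b.1) ≤ _
    rw [dist_eq_norm, dist_eq_norm]
    simp only [Φ, hSsub]
    have e : f - a.1 * a.1 - (f - b.1 * b.1) = -((a.1 + b.1) * (a.1 - b.1)) := by ring
    rw [e]
    refine (hS _).trans ?_
    rw [norm_neg, mul_comm 2 B, mul_assoc, mul_assoc]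
    refine mul_le_mul_of_nonneg_left ((norm_mul_le _ _).trans ?_) hB0
    rw [← mul_assoc]
    refine mul_le_mul_of_nonneg_right ((norm_add_le _ _).trans ?_) (norm_nonneg _)
    linarith
  obtain ⟨q, hq, hfix, -⟩ := hcontr.exists_fixedPoint' Metric.isClosed_closedBall.isComplete hmaps
    (x := 0) (by simpa using hr) (edist_ne_top _ _)
  refine ⟨q, mem_closedBall_zero_iff.1 hq, fun s => ?_⟩
  have hq' : (fun t : ℝ => q (t : AddCircle ℓ)) = linSol p (f - q * q) := by
    funext t
    conv_lhs => rw [← hfix]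
    rfl
  have h := hasDerivAt_linSol p (f - q * q) s
  rw [← hq'] at h
  refine h.congr_deriv ?_
  simp only [ContinuousMap.sub_apply, ContinuousMap.mul_apply]
  ring

/-- `p` solves the Riccati equation `p' + p² = V - lam` on the circle; equivalently `p` is the
logarithmic derivative of a positive solution of `-u'' + V u = lam u`. -/
def IsRiccatiSolution (V : C(AddCircle ℓ, ℝ)) (lam : ℝ) (p : C(AddCircle ℓ, ℝ)) : Prop :=
  ∀ s : ℝ, HasDerivAt (fun t : ℝ => p (t : AddCircle ℓ))
    (V (s : AddCircle ℓ) - lam - p (s : AddCircle ℓ) ^ 2) s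

theorem intFactor_const (m s : ℝ) : intFactor (ContinuousMap.const (AddCircle ℓ) m) s = 2 * m * s := by
  simp only [intFactor, ContinuousMap.const_apply, intervalIntegral.integral_const, smul_eq_mul]
  ring

theorem linSol_const_one [hℓ : Fact (0 < ℓ)] {m : ℝ} (hm : 0 < m) (s : ℝ) :
    linSol (ContinuousMap.const (AddCircle ℓ) m) 1 s = 1 / (2 * m) := by
  have hw : ∀ s, weightedPrimitive (ContinuousMap.const (AddCircle ℓ) m) 1 s
      = (Real.exp (2 * m * s) - 1) / (2 * m) := fun s => by
    simp only [weightedPrimitive, intFactor_const, ContinuousMap.one_apply, mul_one]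
    rw [integral_comp_mul_left (fun x => Real.exp x) (by positivity : 2 * m ≠ 0), integral_exp]
    simp [div_eq_inv_mul]
  have h1 : 0 < Real.exp (2 * m * ℓ) - 1 := by
    have := hℓ.out
    have := Real.one_lt_exp_iff.2 (by positivity : 0 < 2 * m * ℓ)
    linarith
  have he : Real.exp (-(2 * m * s)) * Real.exp (2 * m * s) = 1 := by
    rw [← Real.exp_add]; simp
  simp only [linSol, hw, intFactor_const]
  field_simp
  linear_combination he

theorem intFactor_add (p q : C(AddCircle ℓ, ℝ)) (s : ℝ) :
    intFactor (p + q) s = intFactor p s + intFactor q s := by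
  simp only [intFactor, ContinuousMap.add_apply, mul_add]
  exact integral_add ((continuous_const.mul (continuous_coe_comp p)).intervalIntegrable _ _)
    ((continuous_const.mul (continuous_coe_comp q)).intervalIntegrable _ _)

theorem abs_intFactor_le [hℓ : Fact (0 < ℓ)] (q : C(AddCircle ℓ, ℝ)) :
    |intFactor q ℓ| ≤ 2 * ‖q‖ * ℓ := by
  have h := norm_integral_le_of_norm_le_const (a := 0) (b := ℓ) (C := 2 * ‖q‖)
    (f := fun t : ℝ => 2 * q (t : AddCircle ℓ)) fun t _ => by
      rw [norm_mul, Real.norm_two]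
      exact mul_le_mul_of_nonneg_left (q.norm_coe_le_norm t) zero_le_two
  rwa [sub_zero, abs_of_pos hℓ.out] at h

/-- The values of `lam` for which the Riccati equation has a solution of nonnegative mean. -/
def riccatiSet (V : C(AddCircle ℓ, ℝ)) : Set ℝ :=
  {lam | ∃ p, IsRiccatiSolution V lam p ∧ 0 ≤ intFactor p ℓ}

/-- For zero potential and lam = -m² the constant m is a solution. For m large, V is absorbed by a
correction of norm at most 1 < m, which leaves the mean positive. -/
theorem riccatiSet_nonempty [hℓ : Fact (0 < ℓ)] (V : C(AddCircle ℓ, ℝ)) :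
    (riccatiSet V).Nonempty := by
  have hℓ0 := hℓ.out
  set m := ‖V‖ + 2 with hm
  have hV := norm_nonneg V
  have hm0 : 0 < m := by positivity
  obtain ⟨q, hq, hd⟩ := exists_riccati_correction (ContinuousMap.const (AddCircle ℓ) m) V
    (by rw [intFactor_const]; positivity) (B := 1 / (2 * m)) (r := 1) zero_le_one
    (fun s _ => (linSol_const_one hm0 s).le)
    (by rw [one_div_mul_eq_div, div_le_one (by positivity)]; linarith)
    (by rw [mul_one, mul_one_div, div_lt_one (by positivity)]; linarith)
  refine ⟨-m ^ 2, ContinuousMap.const (AddCircle ℓ) m + q, fun s => ?_, ?_⟩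
  · refine ((hd s).const_add m).congr_deriv ?_
    simp only [ContinuousMap.add_apply, ContinuousMap.const_apply]
    ring
  · rw [intFactor_add, intFactor_const]
    have := neg_le_of_abs_le (abs_intFactor_le q)
    nlinarith

theorem riccatiSet_exists_gt [hℓ : Fact (0 < ℓ)] {V : C(AddCircle ℓ, ℝ)} {lam : ℝ}
    {p : C(AddCircle ℓ, ℝ)} (h : IsRiccatiSolution V lam p) (hp : 0 < intFactor p ℓ) :
    ∃ lam' ∈ riccatiSet V, lam < lam' := by
  have hℓ0 := hℓ.out
  obtain ⟨C, hC⟩ := isCompact_Icc.bddAbove_image (continuous_linSol p 1).continuousOn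
    (K := Icc (0 : ℝ) ℓ)
  set B := max C 1
  have hB0 : 0 < B := lt_max_of_lt_right one_pos
  have hB : ∀ s ∈ Icc (0 : ℝ) ℓ, linSol p 1 s ≤ B := fun s hs =>
    (hC (mem_image_of_mem _ hs)).trans (le_max_left _ _)
  -- The first bound gives contraction and leaves room for raising lam by r/(2B); the second keeps
  -- the mean of p + q nonnegative.
  set r := min (1 / (4 * B)) (intFactor p ℓ / (2 * ℓ))
  have hr0 : 0 < r := by positivity
  have hr1 : r * (4 * B) ≤ 1 := (le_div_iff₀ (by positivity)).1 (min_le_left _ _)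
  have hr2 : r * (2 * ℓ) ≤ intFactor p ℓ := (le_div_iff₀ (by positivity)).1 (min_le_right _ _)
  have hε : 0 < r / (2 * B) := by positivity
  have hf : ‖ContinuousMap.const (AddCircle ℓ) (-(r / (2 * B)))‖ ≤ r / (2 * B) := by
    refine norm_le_of_coe _ hε.le fun s _ => ?_
    rw [ContinuousMap.const_apply, abs_neg, abs_of_pos hε]
  obtain ⟨q, hq, hd⟩ := exists_riccati_correction p
    (ContinuousMap.const (AddCircle ℓ) (-(r / (2 * B)))) hp hr0.le hB
    (by
      have h1 : B * (r / (2 * B)) = r / 2 := by field_simp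
      have h2 := mul_le_mul_of_nonneg_left hf hB0.le
      nlinarith)
    (by linarith)
  refine ⟨lam + r / (2 * B), ⟨p + q, fun s => ?_, ?_⟩, by linarith⟩
  · refine ((h s).add (hd s)).congr_deriv ?_
    simp only [ContinuousMap.add_apply, ContinuousMap.const_apply]
    ring
  · rw [intFactor_add]
    have := neg_le_of_abs_le (abs_intFactor_le q)
    nlinarith

/-- At a maximum of `p` the derivative vanishes, so lam = V - p² there. -/
theorem IsRiccatiSolution.lam_le [hℓ : Fact (0 < ℓ)] {V : C(AddCircle ℓ, ℝ)} {lam : ℝ}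
    {p : C(AddCircle ℓ, ℝ)} (h : IsRiccatiSolution V lam p) : lam ≤ ‖V‖ := by
  obtain ⟨x, -, hx⟩ := isCompact_univ.exists_isMaxOn univ_nonempty p.continuous.continuousOn
  obtain ⟨s, -, rfl⟩ := exists_coe_Icc x
  have h0 := IsLocalMax.hasDerivAt_eq_zero
    (Eventually.of_forall fun t => hx (mem_univ _)) (h s)
  have := le_of_abs_le (abs_coe_le_norm V s)
  nlinarith [sq_nonneg (p (s : AddCircle ℓ))]

/-- At the maximum and the minimum of `p` one has p² = V - lam, and every other value lies between
these two. -/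
theorem IsRiccatiSolution.sq_le [hℓ : Fact (0 < ℓ)] {V : C(AddCircle ℓ, ℝ)} {lam : ℝ}
    {p : C(AddCircle ℓ, ℝ)} (h : IsRiccatiSolution V lam p) (s : ℝ) :
    p (s : AddCircle ℓ) ^ 2 ≤ ‖V‖ - lam := by
  have key : ∀ t : ℝ, HasDerivAt (fun t : ℝ => p (t : AddCircle ℓ)) 0 t →
      p (t : AddCircle ℓ) ^ 2 ≤ ‖V‖ - lam := fun t ht => by
    have h0 := (h t).unique ht
    have := le_of_abs_le (abs_coe_le_norm V t)
    linarith
  obtain ⟨x, -, hx⟩ := isCompact_univ.exists_isMaxOn univ_nonempty p.continuous.continuousOn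
  obtain ⟨a, -, rfl⟩ := exists_coe_Icc x
  obtain ⟨y, -, hy⟩ := isCompact_univ.exists_isMinOn univ_nonempty p.continuous.continuousOn
  obtain ⟨b, -, rfl⟩ := exists_coe_Icc y
  have ha := IsLocalMax.hasDerivAt_eq_zero
    (Eventually.of_forall fun t => hx (mem_univ _)) (h a)
  have hb := IsLocalMin.hasDerivAt_eq_zero
    (Eventually.of_forall fun t => hy (mem_univ _)) (h b)
  have hka := key a (ha ▸ h a)
  have hkb := key b (hb ▸ h b)
  have h1 : p (s : AddCircle ℓ) ≤ p (a : AddCircle ℓ) := hx (mem_univ _)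
  have h2 : p (b : AddCircle ℓ) ≤ p (s : AddCircle ℓ) := hy (mem_univ _)
  rcases le_total 0 (p (s : AddCircle ℓ)) with h3 | h3 <;> nlinarith

theorem lipschitzWith_of_coe {g : AddCircle ℓ → ℝ} {C : NNReal} [hℓ : Fact (0 < ℓ)]
    (h : LipschitzWith C fun s : ℝ => g (s : AddCircle ℓ)) : LipschitzWith C g := by
  refine LipschitzWith.of_dist_le_mul fun x y => ?_
  obtain ⟨s, -, rfl⟩ := exists_coe_Icc x
  obtain ⟨t, -, rfl⟩ := exists_coe_Icc y
  rw [dist_eq_norm (s : AddCircle ℓ), ← AddCircle.coe_sub, AddCircle.norm_eq]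
  -- The circle distance is the real distance after shifting t by the nearest multiple of ℓ.
  set n := round (ℓ⁻¹ * (s - t))
  have e : ((t + n * ℓ : ℝ) : AddCircle ℓ) = t := by
    have := (periodic_coe_comp (ℓ := ℓ) id).int_mul n t
    exact this
  have := h.dist_le_mul s (t + n * ℓ)
  rw [e, Real.dist_eq s, ← sub_sub] at this
  exact this

theorem IsRiccatiSolution.lipschitzWith [hℓ : Fact (0 < ℓ)] {V : C(AddCircle ℓ, ℝ)} {lam : ℝ}
    {p : C(AddCircle ℓ, ℝ)} (h : IsRiccatiSolution V lam p) {C : NNReal}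
    (hC : 2 * (‖V‖ + |lam|) ≤ C) : LipschitzWith C p := by
  refine lipschitzWith_of_coe (lipschitzWith_of_nnnorm_deriv_le
    (fun s => (h s).differentiableAt) fun s => ?_)
  rw [(h s).deriv, ← NNReal.coe_le_coe, coe_nnnorm, Real.norm_eq_abs, abs_le]
  have h1 := abs_le.1 (abs_coe_le_norm V s)
  have h2 := h.sq_le s
  have h3 := abs_le.1 (le_refl |lam|)
  constructor <;> nlinarith [sq_nonneg (p (s : AddCircle ℓ)), norm_nonneg V]

/-- Solutions of the Riccati equation are compact in the parameter. -/
theorem riccati_compactness [hℓ : Fact (0 < ℓ)] {V : C(AddCircle ℓ, ℝ)} {lam : ℕ → ℝ} {lam₀ : ℝ}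
    (hlam : Tendsto lam atTop (𝓝 lam₀)) {p : ℕ → C(AddCircle ℓ, ℝ)}
    (hp : ∀ n, IsRiccatiSolution V (lam n) (p n)) :
    ∃ p₀ : C(AddCircle ℓ, ℝ), ∃ φ : ℕ → ℕ, StrictMono φ ∧ IsRiccatiSolution V lam₀ p₀ ∧
      Tendsto (p ∘ φ) atTop (𝓝 p₀) := by
  obtain ⟨M, hM⟩ : ∃ M, ∀ n, |lam n| ≤ M := by
    obtain ⟨M, hM⟩ := hlam.abs.bddAbove_range
    exact ⟨M, fun n => hM ⟨n, rfl⟩⟩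
  have hM0 : 0 ≤ M := (abs_nonneg _).trans (hM 0)
  set C : NNReal := (2 * (‖V‖ + M)).toNNReal
  have hC : (C : ℝ) = 2 * (‖V‖ + M) := Real.coe_toNNReal _ (by positivity)
  let A : Set (BoundedContinuousFunction (AddCircle ℓ) ℝ) :=
    {g | (∀ x, g x ∈ Icc (-(‖V‖ + M + 1)) (‖V‖ + M + 1)) ∧ LipschitzWith C g}
  have hA : IsCompact (closure A) := by
    refine BoundedContinuousFunction.arzela_ascoli _ isCompact_Icc A (fun g x hg => hg.1 x) ?_
    refine (LipschitzWith.uniformEquicontinuous _ C fun g => g.2.2).equicontinuous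
  have hpA : ∀ n, BoundedContinuousFunction.mkOfCompact (p n) ∈ closure A := fun n => by
    refine subset_closure ⟨fun x => ?_, (hp n).lipschitzWith (by rw [hC]; linarith [hM n])⟩
    obtain ⟨s, -, rfl⟩ := exists_coe_Icc x
    have h1 := (hp n).sq_le s
    have h2 := abs_le.1 (hM n)
    have h3 := norm_nonneg V
    rw [BoundedContinuousFunction.mkOfCompact_apply]
    refine abs_le.1 (abs_le_of_sq_le_sq ?_ (by positivity))
    nlinarith
  obtain ⟨g, -, φ, hφ, hg⟩ := hA.tendsto_subseq hpA
  have hlim : Tendsto (p ∘ φ) atTop (𝓝 g.toContinuousMap) := by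
    rw [ContinuousMap.tendsto_iff_tendstoUniformly]
    exact BoundedContinuousFunction.tendsto_iff_tendstoUniformly.1 hg
  refine ⟨g.toContinuousMap, φ, hφ, ?_, hlim⟩
  -- By the equation the derivatives converge uniformly too, so the limit is differentiable and
  -- satisfies the limiting equation.
  have hlim' : Tendsto (fun n => V - ContinuousMap.const (AddCircle ℓ) (lam (φ n)) - p (φ n) ^ 2)
      atTop (𝓝 (V - ContinuousMap.const (AddCircle ℓ) lam₀ - g.toContinuousMap ^ 2)) := by
    refine (tendsto_const_nhds.sub ?_).sub (hlim.pow 2)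
    exact (ContinuousMap.continuous_const'.tendsto lam₀).comp (hlam.comp hφ.tendsto_atTop)
  have hu := (ContinuousMap.tendsto_iff_tendstoUniformly.1 hlim').comp
    (fun s : ℝ => (s : AddCircle ℓ))
  exact hasDerivAt_of_tendstoUniformly (f := fun n (s : ℝ) => p (φ n) (s : AddCircle ℓ)) hu
    (Eventually.of_forall fun n s => hp (φ n) s)
    fun s => ((ContinuousMap.tendsto_iff_tendstoUniformly.1 hlim).tendsto_at s)

/-- For every potential there is a value `lam` for which the Riccati equation has a solution of mean
zero, that is, `-u'' + V u = lam u` has a positive periodic solution. -/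
theorem exists_riccati_mean_zero [hℓ : Fact (0 < ℓ)] (V : C(AddCircle ℓ, ℝ)) :
    ∃ lam p, IsRiccatiSolution V lam p ∧ intFactor p ℓ = 0 := by
  have hne := riccatiSet_nonempty V
  have hbdd : BddAbove (riccatiSet V) := ⟨‖V‖, fun lam ⟨p, hp, _⟩ => hp.lam_le⟩
  obtain ⟨lam, -, hlim, hmem⟩ := exists_seq_tendsto_sSup hne hbdd
  choose p hp hmean using hmem
  obtain ⟨p₀, φ, -, hp₀, hconv⟩ := riccati_compactness hlim hp
  refine ⟨_, p₀, hp₀, le_antisymm ?_ ?_⟩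
  -- A positive mean would allow lam to be raised beyond the supremum.
  · by_contra! hpos
    obtain ⟨lam', hmem', hlt⟩ := riccatiSet_exists_gt hp₀ hpos
    exact absurd (le_csSup hbdd hmem') (not_le.2 hlt)
  · have h1 : ∀ n, -(2 * ‖p₀ - p (φ n)‖ * ℓ) ≤ intFactor p₀ ℓ := fun n => by
      have h2 := neg_le_of_abs_le (abs_intFactor_le (p₀ - p (φ n)))
      have h3 := intFactor_add (p₀ - p (φ n)) (p (φ n)) ℓ
      rw [sub_add_cancel] at h3
      linarith [hmean (φ n)]
    have h4 : Tendsto (fun n => -(2 * ‖p₀ - p (φ n)‖ * ℓ)) atTop (𝓝 (-(2 * ‖p₀ - p₀‖ * ℓ))) :=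
      (((tendsto_const_nhds.sub hconv).norm.const_mul 2).mul_const ℓ).neg
    rw [sub_self, norm_zero, mul_zero, zero_mul, neg_zero] at h4
    exact le_of_tendsto' h4 h1

/-! ### Eigenvalues and the variational characterization. -/

theorem continuous_of_hasDerivAt {f f' : ℝ → ℝ} (hf : ∀ s, HasDerivAt f (f' s) s) : Continuous f :=
  continuous_iff_continuousAt.2 fun s => (hf s).continuousAt

theorem hasDerivAt_deriv_of_contDiff_two {f : ℝ → ℝ} (hf : ContDiff ℝ 2 f) (s : ℝ) :
    HasDerivAt f (deriv f s) s ∧ HasDerivAt (deriv f) (iteratedDeriv 2 f s) s := by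
  have h1 : ContDiff ℝ 1 (deriv f) := by
    have := (contDiff_succ_iff_deriv (n := 1)).1 (by simpa [one_add_one_eq_two] using hf)
    exact this.2.2
  refine ⟨(hf.differentiable (by norm_num) s).hasDerivAt, ?_⟩
  rw [iteratedDeriv_succ, iteratedDeriv_one]
  exact (h1.differentiable (by norm_num) s).hasDerivAt

theorem contDiff_two_of_hasDerivAt {f f' f'' : ℝ → ℝ} (hf : ∀ s, HasDerivAt f (f' s) s)
    (hf' : ∀ s, HasDerivAt f' (f'' s) s) (hc : Continuous f'') :
    ContDiff ℝ 2 f ∧ iteratedDeriv 2 f = f'' := by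
  have e : deriv f = f' := funext fun s => (hf s).deriv
  have e' : deriv f' = f'' := funext fun s => (hf' s).deriv
  constructor
  · rw [← one_add_one_eq_two]
    refine contDiff_succ_iff_deriv.2 ⟨fun s => (hf s).differentiableAt, by simp, ?_⟩
    rw [e]
    exact contDiff_one_iff_deriv.2 ⟨fun s => (hf' s).differentiableAt, by rwa [e']⟩
  · rw [iteratedDeriv_succ, iteratedDeriv_one, e, e']

theorem isEigenvalue_iff {V : C(AddCircle ℓ, ℝ)} {lam : ℝ} :
    IsEigenvalue ℓ V lam ↔ ∃ u u' : ℝ → ℝ, Function.Periodic u ℓ ∧ (∃ s, u s ≠ 0) ∧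
      (∀ s, HasDerivAt u (u' s) s) ∧
      ∀ s : ℝ, HasDerivAt u' ((V (s : AddCircle ℓ) - lam) * u s) s := by
  constructor
  · rintro ⟨u, hu0, hu, hode⟩
    refine ⟨fun s : ℝ => u s, deriv fun s : ℝ => u s, periodic_coe_comp u, ?_,
      fun s => (hasDerivAt_deriv_of_contDiff_two hu s).1, fun s => ?_⟩
    · by_contra! h
      refine hu0 (funext fun x => ?_)
      obtain ⟨s, rfl⟩ := QuotientAddGroup.mk_surjective x
      exact h s
    · refine (hasDerivAt_deriv_of_contDiff_two hu s).2.congr_deriv ?_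
      linarith [hode s]
  · rintro ⟨u, u', hper, ⟨s₀, hs₀⟩, hu, hu'⟩
    have hc : Continuous fun s : ℝ => (V (s : AddCircle ℓ) - lam) * u s :=
      ((continuous_coe_comp V).sub continuous_const).mul (continuous_of_hasDerivAt hu)
    obtain ⟨h1, h2⟩ := contDiff_two_of_hasDerivAt hu hu' hc
    refine ⟨hper.lift, fun h => hs₀ (congrFun h (s₀ : AddCircle ℓ)), h1, fun s => ?_⟩
    change -iteratedDeriv 2 u s + V (s : AddCircle ℓ) * u s = lam * u s
    rw [h2]
    ring

theorem periodic_of_hasDerivAt {f f' : ℝ → ℝ} (hf : ∀ s, HasDerivAt f (f' s) s)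
    (hp : Function.Periodic f ℓ) : Function.Periodic f' ℓ := fun s => by
  have h := (hf (s + ℓ)).comp_add_const s ℓ
  rw [show (fun x => f (x + ℓ)) = f from funext hp] at h
  exact h.unique (hf s)

theorem antiperiodic_of_hasDerivAt {f f' : ℝ → ℝ} (hf : ∀ s, HasDerivAt f (f' s) s)
    (hp : Function.Antiperiodic f ℓ) : Function.Antiperiodic f' ℓ := fun s => by
  have h := (hf (s + ℓ)).comp_add_const s ℓ
  rw [show (fun x => f (x + ℓ)) = -f from funext hp] at h
  exact h.unique (hf s).neg

/-- Jacobi's inequality: a solution `p` of the Riccati equation `p' + p² = Q` bounds the quadratic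
form `∫ f'² + Q f²` from below by boundary terms. -/
theorem jacobi_inequality {a b : ℝ} (hab : a ≤ b) {p Q f f' : ℝ → ℝ} (hQ : Continuous Q)
    (hp : ∀ s ∈ Icc a b, HasDerivAt p (Q s - p s ^ 2) s) (hf : ∀ s, HasDerivAt f (f' s) s)
    (hf' : Continuous f') :
    p b * f b ^ 2 - p a * f a ^ 2 ≤ ∫ s in a..b, (f' s ^ 2 + Q s * f s ^ 2) := by
  have hfc := continuous_of_hasDerivAt hf
  have hpc : ContinuousOn p (uIcc a b) := fun s hs =>
    (hp s (by rwa [uIcc_of_le hab] at hs)).continuousAt.continuousWithinAt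
  have hint : IntervalIntegrable
      (fun s => (Q s - p s ^ 2) * f s ^ 2 + p s * (2 * f s * f' s)) volume a b := by
    refine ContinuousOn.intervalIntegrable ?_
    have h1 := hQ.continuousOn (s := uIcc a b)
    have h2 := hfc.continuousOn (s := uIcc a b)
    have h3 := hf'.continuousOn (s := uIcc a b)
    fun_prop
  rw [← integral_eq_sub_of_hasDerivAt (f := fun s => p s * f s ^ 2) (fun s hs => by
    refine ((hp s (by rwa [uIcc_of_le hab] at hs)).mul ((hf s).pow 2)).congr_deriv ?_
    simp) hint]
  refine integral_mono_on hab hint (Continuous.intervalIntegrable (by fun_prop) _ _) fun s _ => ?_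
  -- The integrands differ by the square (f' - p f)².
  nlinarith [sq_nonneg (f' s - p s * f s)]

/-- Since `p` is periodic, the boundary terms in Jacobi's inequality cancel. Only equal endpoint
values of f are needed, so sin(πs/ℓ), which is not ℓ-periodic, is an admissible test function. -/
theorem IsRiccatiSolution.rayleigh [hℓ : Fact (0 < ℓ)] {V : C(AddCircle ℓ, ℝ)} {lam : ℝ}
    {p : C(AddCircle ℓ, ℝ)} (h : IsRiccatiSolution V lam p) {f f' : ℝ → ℝ}
    (hf : ∀ s, HasDerivAt f (f' s) s) (hf' : Continuous f') (h0 : f ℓ = f 0) :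
    lam * ∫ s in (0 : ℝ)..ℓ, f s ^ 2
      ≤ (∫ s in (0 : ℝ)..ℓ, f' s ^ 2) + ∫ s in (0 : ℝ)..ℓ, V (s : AddCircle ℓ) * f s ^ 2 := by
  have hfc := continuous_of_hasDerivAt hf
  have hV := continuous_coe_comp V
  have hj := jacobi_inequality (Q := fun s : ℝ => V (s : AddCircle ℓ) - lam) hℓ.out.le
    (hV.sub continuous_const) (fun s _ => h s) hf hf'
  have hpe : p ((ℓ : ℝ) : AddCircle ℓ) = p ((0 : ℝ) : AddCircle ℓ) := by
    rw [AddCircle.coe_period, AddCircle.coe_zero]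
  rw [hpe, h0, sub_self] at hj
  have hi1 : IntervalIntegrable (fun s => f' s ^ 2) volume 0 ℓ :=
    (hf'.pow 2).intervalIntegrable _ _
  have hi2 : IntervalIntegrable (fun s : ℝ => V (s : AddCircle ℓ) * f s ^ 2) volume 0 ℓ :=
    (hV.mul (hfc.pow 2)).intervalIntegrable _ _
  have hi3 : IntervalIntegrable (fun s => lam * f s ^ 2) volume 0 ℓ :=
    (continuous_const.mul (hfc.pow 2)).intervalIntegrable _ _
  have e : ∫ s in (0 : ℝ)..ℓ, (f' s ^ 2 + (V (s : AddCircle ℓ) - lam) * f s ^ 2)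
      = (∫ s in (0 : ℝ)..ℓ, f' s ^ 2) + (∫ s in (0 : ℝ)..ℓ, V (s : AddCircle ℓ) * f s ^ 2)
        - lam * ∫ s in (0 : ℝ)..ℓ, f s ^ 2 := by
    rw [← intervalIntegral.integral_const_mul, ← integral_add hi1 hi2,
      ← integral_sub (hi1.add hi2) hi3]
    refine integral_congr fun s _ => ?_
    ring
  rw [e] at hj
  linarith

/-- The energy identity for solutions of `-u'' + V u = lam u`. -/
theorem energy_identity {V : C(AddCircle ℓ, ℝ)} {lam : ℝ} {u u' : ℝ → ℝ}
    (hper : Function.Periodic u ℓ) (hu : ∀ s, HasDerivAt u (u' s) s)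
    (hu' : ∀ s : ℝ, HasDerivAt u' ((V (s : AddCircle ℓ) - lam) * u s) s) :
    lam * ∫ s in (0 : ℝ)..ℓ, u s ^ 2
      = (∫ s in (0 : ℝ)..ℓ, u' s ^ 2) + ∫ s in (0 : ℝ)..ℓ, V (s : AddCircle ℓ) * u s ^ 2 := by
  have hc := continuous_of_hasDerivAt hu
  have hc' := continuous_of_hasDerivAt hu'
  have hV := continuous_coe_comp V
  have hi1 : IntervalIntegrable (fun s => u' s ^ 2) volume 0 ℓ :=
    (hc'.pow 2).intervalIntegrable _ _
  have hi2 : IntervalIntegrable (fun s : ℝ => V (s : AddCircle ℓ) * u s ^ 2) volume 0 ℓ :=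
    (hV.mul (hc.pow 2)).intervalIntegrable _ _
  have hi3 : IntervalIntegrable (fun s => lam * u s ^ 2) volume 0 ℓ :=
    (continuous_const.mul (hc.pow 2)).intervalIntegrable _ _
  have hper' := periodic_of_hasDerivAt hu hper
  have h0 := integral_eq_sub_of_hasDerivAt (a := 0) (b := ℓ) (fun s _ => (hu s).mul (hu' s))
    (Continuous.intervalIntegrable (by fun_prop) _ _)
  -- The integral of (u u')' over a period vanishes.
  have e1 : u ℓ = u 0 := by simpa using hper 0
  have e2 : u' ℓ = u' 0 := by simpa using hper' 0
  simp only [Pi.mul_apply, e1, e2, sub_self] at h0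
  rw [← intervalIntegral.integral_const_mul, ← sub_eq_zero, ← neg_eq_zero, neg_sub,
    ← integral_add hi1 hi2, ← integral_sub (hi1.add hi2) hi3]
  refine (integral_congr fun s _ => ?_).trans h0
  ring

theorem integral_sq_pos [hℓ : Fact (0 < ℓ)] {u : ℝ → ℝ} (hc : Continuous u)
    (hper : Function.Periodic u ℓ) (h : ∃ s, u s ≠ 0) : 0 < ∫ s in (0 : ℝ)..ℓ, u s ^ 2 := by
  obtain ⟨s, hs⟩ := h
  obtain ⟨t, ht, e⟩ := hper.exists_mem_Ico₀ hℓ.out s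
  exact integral_pos hℓ.out (hc.pow 2).continuousOn (fun _ _ => sq_nonneg _)
    ⟨t, Ico_subset_Icc_self ht, by rw [← e]; positivity⟩

/-- The positive function with logarithmic derivative `p`. -/
def groundState (p : C(AddCircle ℓ, ℝ)) (s : ℝ) : ℝ := Real.exp (intFactor p s / 2)

theorem groundState_pos (p : C(AddCircle ℓ, ℝ)) (s : ℝ) : 0 < groundState p s := Real.exp_pos _

theorem hasDerivAt_groundState (p : C(AddCircle ℓ, ℝ)) (s : ℝ) :
    HasDerivAt (groundState p) (p (s : AddCircle ℓ) * groundState p s) s := by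
  refine ((hasDerivAt_intFactor p s).div_const 2).exp.congr_deriv ?_
  simp only [groundState]
  ring

theorem periodic_groundState {p : C(AddCircle ℓ, ℝ)} (hp : intFactor p ℓ = 0) :
    Function.Periodic (groundState p) ℓ := fun s => by
  simp only [groundState, intFactor_add_period, hp, add_zero]

theorem IsRiccatiSolution.hasDerivAt_deriv_groundState {V : C(AddCircle ℓ, ℝ)} {lam : ℝ}
    {p : C(AddCircle ℓ, ℝ)} (h : IsRiccatiSolution V lam p) (s : ℝ) :
    HasDerivAt (fun s : ℝ => p (s : AddCircle ℓ) * groundState p s)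
      ((V (s : AddCircle ℓ) - lam) * groundState p s) s := by
  refine ((h s).mul (hasDerivAt_groundState p s)).congr_deriv ?_
  ring

/-- The ground state realizes lam, and the Rayleigh bound applied to any eigenfunction excludes
smaller eigenvalues. -/
theorem IsRiccatiSolution.isLeast [hℓ : Fact (0 < ℓ)] {V : C(AddCircle ℓ, ℝ)} {lam : ℝ}
    {p : C(AddCircle ℓ, ℝ)} (h : IsRiccatiSolution V lam p) (hp : intFactor p ℓ = 0) :
    IsLeast {lam | IsEigenvalue ℓ V lam} lam := by
  refine ⟨isEigenvalue_iff.2 ⟨groundState p, _, periodic_groundState hp,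
    ⟨0, (groundState_pos p 0).ne'⟩, hasDerivAt_groundState p,
    h.hasDerivAt_deriv_groundState⟩, fun μ hμ => ?_⟩
  obtain ⟨u, u', hper, hne, hu, hu'⟩ := isEigenvalue_iff.1 hμ
  have h1 := h.rayleigh hu (continuous_of_hasDerivAt hu') (by simpa using hper 0)
  rw [← energy_identity hper hu hu'] at h1
  exact le_of_mul_le_mul_right h1 (integral_sq_pos (continuous_of_hasDerivAt hu) hper hne)

/-! ### Wirtinger inequalities and the sharp inequality for positive functions. -/

/-- Wirtinger's inequality on an interval with Dirichlet conditions. -/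
theorem wirtinger_dirichlet {a : ℝ} (hℓ : 0 < ℓ) {f f' : ℝ → ℝ} (hf : ∀ s, HasDerivAt f (f' s) s)
    (hf' : Continuous f') (ha : f a = 0) (hb : f (a + ℓ) = 0) :
    (Real.pi / ℓ) ^ 2 * ∫ s in a..a + ℓ, f s ^ 2 ≤ ∫ s in a..a + ℓ, f' s ^ 2 := by
  have hfc := continuous_of_hasDerivAt hf
  have hk0 : 0 < Real.pi / ℓ := div_pos Real.pi_pos hℓ
  have key : ∀ k ∈ Ioo 0 (Real.pi / ℓ),
      k ^ 2 * ∫ s in a..a + ℓ, f s ^ 2 ≤ ∫ s in a..a + ℓ, f' s ^ 2 := by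
    rintro k ⟨hk, hk'⟩
    rw [lt_div_iff₀ hℓ] at hk'
    have hp : ∀ s ∈ Icc a (a + ℓ), HasDerivAt (fun s => -k * Real.tan (k * (s - a - ℓ / 2)))
        (-k ^ 2 - (-k * Real.tan (k * (s - a - ℓ / 2))) ^ 2) s := by
      rintro s ⟨h1, h2⟩
      have hcos : 0 < Real.cos (k * (s - a - ℓ / 2)) :=
        Real.cos_pos_of_mem_Ioo ⟨by nlinarith, by nlinarith⟩
      have hlin : HasDerivAt (fun s => k * (s - a - ℓ / 2)) (k * 1) s :=
        (((hasDerivAt_id s).sub_const a).sub_const (ℓ / 2)).const_mul k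
      refine (((Real.hasDerivAt_tan hcos.ne').comp s hlin).const_mul (-k)).congr_deriv ?_
      have := Real.sin_sq_add_cos_sq (k * (s - a - ℓ / 2))
      rw [Real.tan_eq_sin_div_cos]
      generalize k * (s - a - ℓ / 2) = x at *
      field_simp
      linear_combination this
    have hj := jacobi_inequality (by linarith : a ≤ a + ℓ) (continuous_const (y := -k ^ 2)) hp hf hf'
    rw [ha, hb, integral_add (Continuous.intervalIntegrable (by fun_prop) _ _)
      (Continuous.intervalIntegrable (by fun_prop) _ _),
      intervalIntegral.integral_const_mul] at hj
    linarith
  have ht : Tendsto (fun k : ℝ => k ^ 2 * ∫ s in a..a + ℓ, f s ^ 2) (𝓝[<] (Real.pi / ℓ))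
      (𝓝 ((Real.pi / ℓ) ^ 2 * ∫ s in a..a + ℓ, f s ^ 2)) :=
    (Continuous.tendsto (by fun_prop) _).mono_left nhdsWithin_le_nhds
  refine le_of_tendsto ht ?_
  filter_upwards [Ioo_mem_nhdsLT hk0] with k hk using key k hk

/-- Wirtinger's inequality for antiperiodic functions. -/
theorem wirtinger_antiperiodic (hℓ : 0 < ℓ) {f f' : ℝ → ℝ} (hf : ∀ s, HasDerivAt f (f' s) s)
    (hf' : Continuous f') (hanti : Function.Antiperiodic f ℓ) :
    (Real.pi / ℓ) ^ 2 * ∫ s in (0 : ℝ)..ℓ, f s ^ 2 ≤ ∫ s in (0 : ℝ)..ℓ, f' s ^ 2 := by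
  have hfℓ : f ℓ = -f 0 := by simpa using hanti 0
  obtain ⟨a, -, ha⟩ : (0 : ℝ) ∈ f '' uIcc 0 ℓ := by
    refine intermediate_value_uIcc (continuous_of_hasDerivAt hf).continuousOn ?_
    rw [hfℓ, mem_uIcc]
    rcases le_total 0 (f 0) with h | h
    · exact Or.inr ⟨by linarith, h⟩
    · exact Or.inl ⟨h, by linarith⟩
  have hsq : ∀ g : ℝ → ℝ, Function.Antiperiodic g ℓ →
      ∫ s in a..a + ℓ, g s ^ 2 = ∫ s in (0 : ℝ)..ℓ, g s ^ 2 := fun g hg => by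
    have hper : Function.Periodic (fun s => g s ^ 2) ℓ := fun s => by
      simp only [hg s, neg_sq]
    rw [hper.intervalIntegral_add_eq a 0, zero_add]
  have h := wirtinger_dirichlet hℓ hf hf' ha (by rw [hanti a, ha, neg_zero])
  rwa [hsq f hanti, hsq f' (antiperiodic_of_hasDerivAt hf hanti)] at h

/-- A sharp inequality for positive periodic functions, obtained by applying Wirtinger's inequality
to the antiperiodic planar curve with radius `u` and angular velocity proportional to `u⁻²`. -/
theorem ermakov_inequality [hℓ : Fact (0 < ℓ)] {u u' : ℝ → ℝ} (hu : ∀ s, HasDerivAt u (u' s) s)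
    (hu' : Continuous u') (hper : Function.Periodic u ℓ) (hpos : ∀ s, 0 < u s) :
    (Real.pi / ℓ) ^ 2 * ∫ s in (0 : ℝ)..ℓ, u s ^ 2
      ≤ (∫ s in (0 : ℝ)..ℓ, u' s ^ 2) + Real.pi ^ 2 / ∫ s in (0 : ℝ)..ℓ, (u s ^ 2)⁻¹ := by
  have hc := continuous_of_hasDerivAt hu
  have hne : ∀ s, u s ≠ 0 := fun s => (hpos s).ne'
  have hci : Continuous fun s => (u s ^ 2)⁻¹ := (hc.pow 2).inv₀ fun s => pow_ne_zero 2 (hne s)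
  set I := ∫ s in (0 : ℝ)..ℓ, (u s ^ 2)⁻¹ with hI
  have hI0 : 0 < I := intervalIntegral_pos_of_pos (hci.intervalIntegrable _ _)
    (fun s => inv_pos.2 (pow_pos (hpos s) 2)) hℓ.out
  -- With this c the angle φ advances by π over one period, so u cos φ and u sin φ are antiperiodic.
  set c := Real.pi / I with hcdef
  let φ : ℝ → ℝ := fun s => c * ∫ t in (0 : ℝ)..s, (u t ^ 2)⁻¹
  have hφ : ∀ s, HasDerivAt φ (c * (u s ^ 2)⁻¹) s := fun s =>
    (integral_hasDerivAt_right (hci.intervalIntegrable _ _)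
      hci.stronglyMeasurable.stronglyMeasurableAtFilter hci.continuousAt).const_mul c
  have hφc := continuous_of_hasDerivAt hφ
  have hφper : ∀ s, φ (s + ℓ) = φ s + Real.pi := fun s => by
    have h := integral_add_period (ℓ := ℓ) hci (fun s => by simp only [hper s]) s
    simp only [φ]
    rw [h, ← hI, mul_add, hcdef, div_mul_cancel₀ _ hI0.ne']
  have hf : ∀ s, HasDerivAt (fun s => u s * Real.cos (φ s))
      (u' s * Real.cos (φ s) - c * (u s)⁻¹ * Real.sin (φ s)) s := fun s => by
    refine ((hu s).mul (hφ s).cos).congr_deriv ?_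
    have := hne s
    field_simp
    ring
  have hg : ∀ s, HasDerivAt (fun s => u s * Real.sin (φ s))
      (u' s * Real.sin (φ s) + c * (u s)⁻¹ * Real.cos (φ s)) s := fun s => by
    refine ((hu s).mul (hφ s).sin).congr_deriv ?_
    have := hne s
    field_simp
  have hui : Continuous fun s => (u s)⁻¹ := hc.inv₀ hne
  have hsin := Real.continuous_sin.comp hφc
  have hcos := Real.continuous_cos.comp hφc
  have hf'c : Continuous fun s => u' s * Real.cos (φ s) - c * (u s)⁻¹ * Real.sin (φ s) := by fun_prop
  have hg'c : Continuous fun s => u' s * Real.sin (φ s) + c * (u s)⁻¹ * Real.cos (φ s) := by fun_prop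
  have h1 := wirtinger_antiperiodic hℓ.out hf hf'c fun s => by
    simp only [hφper, hper s, Real.cos_add_pi]; ring
  have h2 := wirtinger_antiperiodic hℓ.out hg hg'c fun s => by
    simp only [hφper, hper s, Real.sin_add_pi]; ring
  have e1 : (∫ s in (0 : ℝ)..ℓ, (u s * Real.cos (φ s)) ^ 2)
      + (∫ s in (0 : ℝ)..ℓ, (u s * Real.sin (φ s)) ^ 2) = ∫ s in (0 : ℝ)..ℓ, u s ^ 2 := by
    rw [← integral_add (Continuous.intervalIntegrable (by fun_prop) _ _)
      (Continuous.intervalIntegrable (by fun_prop) _ _)]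
    refine integral_congr fun s _ => ?_
    linear_combination u s ^ 2 * Real.sin_sq_add_cos_sq (φ s)
  have e2 : (∫ s in (0 : ℝ)..ℓ, (u' s * Real.cos (φ s) - c * (u s)⁻¹ * Real.sin (φ s)) ^ 2)
      + (∫ s in (0 : ℝ)..ℓ, (u' s * Real.sin (φ s) + c * (u s)⁻¹ * Real.cos (φ s)) ^ 2)
      = (∫ s in (0 : ℝ)..ℓ, u' s ^ 2) + Real.pi ^ 2 / I := by
    have hcI : Real.pi ^ 2 / I = c ^ 2 * I := by rw [hcdef]; field_simp
    rw [hcI, hI, ← intervalIntegral.integral_const_mul,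
      ← integral_add (Continuous.intervalIntegrable (by fun_prop) _ _)
      (Continuous.intervalIntegrable (by fun_prop) _ _),
      ← integral_add (Continuous.intervalIntegrable (by fun_prop) _ _)
      (Continuous.intervalIntegrable (by fun_prop) _ _)]
    refine integral_congr fun s _ => ?_
    simp only [← inv_pow]
    linear_combination (u' s ^ 2 + c ^ 2 * (u s)⁻¹ ^ 2) * Real.sin_sq_add_cos_sq (φ s)
  rw [← e1, ← e2, mul_add]
  exact add_le_add h1 h2

/-! ### The first positive Laplace eigenvalue. -/

theorem isLeast_positiveLaplaceEigenvalues [hℓ : Fact (0 < ℓ)] :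
    IsLeast (positiveLaplaceEigenvalues ℓ) ((2 * Real.pi / ℓ) ^ 2) := by
  have hℓ0 := hℓ.out
  have hω : 0 < 2 * Real.pi / ℓ := by have := Real.pi_pos; positivity
  refine ⟨⟨by positivity, isEigenvalue_iff.2 ?_⟩, ?_⟩
  · refine ⟨fun s => Real.cos (2 * Real.pi / ℓ * s),
      fun s => -(2 * Real.pi / ℓ) * Real.sin (2 * Real.pi / ℓ * s), fun s => ?_, ⟨0, by simp⟩,
      fun s => ?_, fun s => ?_⟩
    · simp only [mul_add, div_mul_cancel₀ _ hℓ0.ne', Real.cos_add_two_pi]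
    · refine (((hasDerivAt_id s).const_mul (2 * Real.pi / ℓ)).cos).congr_deriv ?_
      simp only [id]
      ring
    · refine ((((hasDerivAt_id s).const_mul (2 * Real.pi / ℓ)).sin).const_mul _).congr_deriv ?_
      simp only [id, ContinuousMap.zero_apply]
      ring
  · rintro μ ⟨hμ, hev⟩
    obtain ⟨u, u', hper, ⟨s₀, hs₀⟩, hu, hu'⟩ := isEigenvalue_iff.1 hev
    set ω := Real.sqrt μ with hωdef
    have hω0 : 0 < ω := Real.sqrt_pos.2 hμ
    have hωsq : ω ^ 2 = μ := Real.sq_sqrt hμ.le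
    have hωsq' : (ω : ℂ) ^ 2 = μ := by exact_mod_cast hωsq
    -- The quantity (u' + iωu)e^{-iωs} is conserved and its first factor is periodic and nonzero at
    -- s₀, so e^{-iωℓ} = 1 and ω is a positive multiple of 2π/ℓ.
    let z : ℝ → ℂ := fun s =>
      ((u' s : ℂ) + ω * Complex.I * u s) * Complex.exp (-(ω * Complex.I) * s)
    have hz : ∀ s, HasDerivAt z 0 s := fun s => by
      have h1 := (hu' s).ofReal_comp.add (((hu s).ofReal_comp).const_mul ((ω : ℂ) * Complex.I))
      have h2 : HasDerivAt (fun s : ℝ => Complex.exp (-(ω * Complex.I) * s))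
          (Complex.exp (-(ω * Complex.I) * s) * (-(ω * Complex.I) * 1)) s :=
        ((Complex.ofRealCLM.hasDerivAt (x := s)).const_mul (-((ω : ℂ) * Complex.I))).cexp
      refine (h1.mul h2).congr_deriv ?_
      simp only [Pi.add_apply, ContinuousMap.zero_apply, zero_sub, Complex.ofReal_mul,
        Complex.ofReal_neg, ← hωsq']
      linear_combination (-(ω : ℂ) ^ 2 * u s * Complex.exp (-(ω * Complex.I) * s)) * Complex.I_sq
    have hconst : ∀ s t, z s = z t := is_const_of_deriv_eq_zero
      (fun s => (hz s).differentiableAt) fun s => (hz s).deriv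
    have hu0 : (u' s₀ : ℂ) + ω * Complex.I * u s₀ ≠ 0 := fun h => by
      have := congrArg Complex.im h
      simp at this
      rcases this with h | h
      · exact hω0.ne' h
      · exact hs₀ h
    have hexp := hconst (s₀ + ℓ) s₀
    simp only [z, hper s₀, periodic_of_hasDerivAt hu hper s₀] at hexp
    have hexp' := mul_left_cancel₀ hu0 hexp
    rw [Complex.ofReal_add, mul_add, Complex.exp_add] at hexp'
    have hone := mul_left_cancel₀ (Complex.exp_ne_zero _) (hexp'.trans (mul_one _).symm)
    obtain ⟨n, hn⟩ := Complex.exp_eq_one_iff.1 hone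
    have hn' : ω * ℓ = (-n : ℤ) * (2 * Real.pi) := by
      have := congrArg Complex.im hn
      simp at this
      push_cast
      linarith
    have hnpos : (0 : ℝ) < (-n : ℤ) := by
      have h1 : 0 < ω * ℓ := mul_pos hω0 hℓ0
      rw [hn'] at h1
      exact pos_of_mul_pos_left h1 (by have := Real.pi_pos; positivity)
    have hn1 : (1 : ℝ) ≤ (-n : ℤ) := by
      have : (0 : ℤ) < -n := by exact_mod_cast hnpos
      exact_mod_cast this
    rw [← hωsq]
    refine pow_le_pow_left₀ hω.le ?_ 2
    rw [div_le_iff₀ hℓ0, hn']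
    have := Real.pi_pos
    nlinarith

theorem mu1_eq [Fact (0 < ℓ)] : mu1 ℓ = (2 * Real.pi / ℓ) ^ 2 :=
  isLeast_positiveLaplaceEigenvalues.csInf_eq

/-! ### Lower bounds for the principal eigenvalue on the constraint class. -/

theorem mem_K_iff [hℓ : Fact (0 < ℓ)] {κ₀ : ℝ} {κ : C(AddCircle ℓ, ℝ)} :
    κ ∈ K ℓ κ₀ ↔ ∫ s in (0 : ℝ)..ℓ, κ (s : AddCircle ℓ) = ℓ * κ₀ := by
  have h := AddCircle.intervalIntegral_preimage ℓ 0 κ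
  rw [zero_add] at h
  have hℓ0 := hℓ.out
  rw [K, mem_ofPred_eq, ← h, one_div_mul_eq_div, div_eq_iff hℓ0.ne', mul_comm]

theorem const_mem_K [hℓ : Fact (0 < ℓ)] (κ₀ : ℝ) :
    ContinuousMap.const (AddCircle ℓ) κ₀ ∈ K ℓ κ₀ :=
  mem_K_iff.2 (by simp)

theorem potential_sqFun_apply (α : ℝ) (κ : C(AddCircle ℓ, ℝ)) (x : AddCircle ℓ) :
    potential sqFun α κ x = α * κ x ^ 2 := rfl

theorem exists_riccati_lambda0 [Fact (0 < ℓ)] (F : C(ℝ, ℝ)) (α : ℝ) (κ : C(AddCircle ℓ, ℝ)) :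
    ∃ p, IsRiccatiSolution (potential F α κ) (lambda0 F α κ) p ∧ intFactor p ℓ = 0 := by
  obtain ⟨lam, p, h, hp⟩ := exists_riccati_mean_zero (potential F α κ)
  have e : lambda0 F α κ = lam := (h.isLeast hp).csInf_eq
  exact ⟨p, e ▸ h, hp⟩

theorem lambda0_const [Fact (0 < ℓ)] (α κ₀ : ℝ) :
    lambda0 sqFun α (ContinuousMap.const (AddCircle ℓ) κ₀) = α * κ₀ ^ 2 := by
  have h : IsRiccatiSolution (potential sqFun α (ContinuousMap.const (AddCircle ℓ) κ₀))
      (α * κ₀ ^ 2) 0 := fun s => by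
    refine (hasDerivAt_const s (0 : ℝ)).congr_deriv ?_
    simp [potential_sqFun_apply]
  exact (h.isLeast (by simp [intFactor])).csInf_eq

/-- The Cauchy–Schwarz inequality `(∫ g)² ≤ (∫ g² u²) (∫ u⁻²)`. -/
theorem sq_integral_div_le [hℓ : Fact (0 < ℓ)] {g u : ℝ → ℝ} (hg : Continuous g)
    (hu : Continuous u) (hpos : ∀ s, 0 < u s) :
    (∫ s in (0 : ℝ)..ℓ, g s) ^ 2 / (∫ s in (0 : ℝ)..ℓ, (u s ^ 2)⁻¹)
      ≤ ∫ s in (0 : ℝ)..ℓ, g s ^ 2 * u s ^ 2 := by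
  have hne : ∀ s, u s ≠ 0 := fun s => (hpos s).ne'
  have hci : Continuous fun s => (u s ^ 2)⁻¹ := (hu.pow 2).inv₀ fun s => pow_ne_zero 2 (hne s)
  set I := ∫ s in (0 : ℝ)..ℓ, (u s ^ 2)⁻¹ with hI
  set T := ∫ s in (0 : ℝ)..ℓ, g s with hT
  have hI0 : 0 < I := intervalIntegral_pos_of_pos (hci.intervalIntegrable _ _)
    (fun s => inv_pos.2 (pow_pos (hpos s) 2)) hℓ.out
  -- This integrates (g u - t/u)² ≥ 0 at the optimal multiplier t = T/I.
  have h : ∫ s in (0 : ℝ)..ℓ, (2 * (T / I) * g s - (T / I) ^ 2 * (u s ^ 2)⁻¹)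
      ≤ ∫ s in (0 : ℝ)..ℓ, g s ^ 2 * u s ^ 2 := by
    refine integral_mono_on hℓ.out.le (Continuous.intervalIntegrable (by fun_prop) _ _)
      (Continuous.intervalIntegrable (by fun_prop) _ _) fun s _ => ?_
    have h1 := sq_nonneg (g s * u s - T / I * (u s)⁻¹)
    have h2 : u s * (u s)⁻¹ = 1 := mul_inv_cancel₀ (hne s)
    rw [← inv_pow]
    have h3 : (g s * u s - T / I * (u s)⁻¹) ^ 2
        = g s ^ 2 * u s ^ 2 - (2 * (T / I) * g s - (T / I) ^ 2 * (u s)⁻¹ ^ 2) := by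
      linear_combination (-2 * g s * (T / I)) * h2
    linarith
  rw [integral_sub (Continuous.intervalIntegrable (by fun_prop) _ _)
    (Continuous.intervalIntegrable (by fun_prop) _ _), intervalIntegral.integral_const_mul,
    intervalIntegral.integral_const_mul, ← hI, ← hT] at h
  refine le_trans (le_of_eq ?_) h
  field_simp
  ring

/-- The lower bound for the principal eigenvalue in terms of the ground state. -/
theorem lambda0_mul_integral_ge [hℓ : Fact (0 < ℓ)] {κ₀ α : ℝ} (hα : 0 < α)
    {κ p : C(AddCircle ℓ, ℝ)} (hκ : κ ∈ K ℓ κ₀)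
    (h : IsRiccatiSolution (potential sqFun α κ) (lambda0 sqFun α κ) p) (hp : intFactor p ℓ = 0) :
    (∫ s in (0 : ℝ)..ℓ, (p (s : AddCircle ℓ) * groundState p s) ^ 2)
        + α * ((ℓ * κ₀) ^ 2 / ∫ s in (0 : ℝ)..ℓ, (groundState p s ^ 2)⁻¹)
      ≤ lambda0 sqFun α κ * ∫ s in (0 : ℝ)..ℓ, groundState p s ^ 2 := by
  have he := energy_identity (periodic_groundState hp) (hasDerivAt_groundState p)
    h.hasDerivAt_deriv_groundState
  have hcs := sq_integral_div_le (ℓ := ℓ) (continuous_coe_comp κ)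
    (continuous_of_hasDerivAt (hasDerivAt_groundState p)) (groundState_pos p)
  rw [mem_K_iff.1 hκ] at hcs
  have e : ∫ s in (0 : ℝ)..ℓ, potential sqFun α κ (s : AddCircle ℓ) * groundState p s ^ 2
      = α * ∫ s in (0 : ℝ)..ℓ, κ (s : AddCircle ℓ) ^ 2 * groundState p s ^ 2 := by
    rw [← intervalIntegral.integral_const_mul]
    refine integral_congr fun s _ => ?_
    simp only [potential_sqFun_apply]
    ring
  rw [he, e]
  exact add_le_add le_rfl (mul_le_mul_of_nonneg_left hcs hα.le)

theorem ermakov_groundState [hℓ : Fact (0 < ℓ)] {p : C(AddCircle ℓ, ℝ)} (hp : intFactor p ℓ = 0) :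
    (Real.pi / ℓ) ^ 2 * ∫ s in (0 : ℝ)..ℓ, groundState p s ^ 2
      ≤ (∫ s in (0 : ℝ)..ℓ, (p (s : AddCircle ℓ) * groundState p s) ^ 2)
        + Real.pi ^ 2 / ∫ s in (0 : ℝ)..ℓ, (groundState p s ^ 2)⁻¹ :=
  ermakov_inequality (hasDerivAt_groundState p)
    ((continuous_coe_comp p).mul (continuous_of_hasDerivAt (hasDerivAt_groundState p)))
    (periodic_groundState hp) (groundState_pos p)

theorem integral_groundState_sq_pos [hℓ : Fact (0 < ℓ)] {p : C(AddCircle ℓ, ℝ)}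
    (hp : intFactor p ℓ = 0) : 0 < ∫ s in (0 : ℝ)..ℓ, groundState p s ^ 2 :=
  integral_sq_pos (continuous_of_hasDerivAt (hasDerivAt_groundState p)) (periodic_groundState hp)
    ⟨0, (groundState_pos p 0).ne'⟩

theorem integral_groundState_inv_sq_pos [hℓ : Fact (0 < ℓ)] (p : C(AddCircle ℓ, ℝ)) :
    0 < ∫ s in (0 : ℝ)..ℓ, (groundState p s ^ 2)⁻¹ := by
  have hc := continuous_of_hasDerivAt (hasDerivAt_groundState p)
  exact intervalIntegral_pos_of_pos (((hc.pow 2).inv₀ fun s =>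
    pow_ne_zero 2 (groundState_pos p s).ne').intervalIntegrable _ _)
    (fun s => inv_pos.2 (pow_pos (groundState_pos p s) 2)) hℓ.out

/-- A function in `K` whose square is at most `κ₀²` is the constant `κ₀`. -/
theorem eq_const_of_sq_le [hℓ : Fact (0 < ℓ)] {κ₀ : ℝ} {κ : C(AddCircle ℓ, ℝ)}
    (hκ : κ ∈ K ℓ κ₀) (hsq : ∀ s : ℝ, κ (s : AddCircle ℓ) ^ 2 ≤ κ₀ ^ 2) :
    κ = ContinuousMap.const (AddCircle ℓ) κ₀ := by
  by_contra hne
  have hc := continuous_coe_comp κ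
  have hpos : 0 < ∫ s in (0 : ℝ)..ℓ, (κ (s : AddCircle ℓ) - κ₀) ^ 2 := by
    refine integral_sq_pos (hc.sub continuous_const) (periodic_coe_comp fun x => κ x - κ₀) ?_
    by_contra! h
    refine hne (ContinuousMap.ext fun x => ?_)
    obtain ⟨s, -, rfl⟩ := exists_coe_Icc x
    exact sub_eq_zero.1 (h s)
  -- The right-hand side has zero integral by the mean constraint.
  have hle : ∫ s in (0 : ℝ)..ℓ, (κ (s : AddCircle ℓ) - κ₀) ^ 2
      ≤ ∫ s in (0 : ℝ)..ℓ, 2 * κ₀ * (κ₀ - κ (s : AddCircle ℓ)) := by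
    refine integral_mono_on hℓ.out.le (Continuous.intervalIntegrable (by fun_prop) _ _)
      (Continuous.intervalIntegrable (by fun_prop) _ _) fun s _ => ?_
    nlinarith [hsq s]
  rw [intervalIntegral.integral_const_mul, integral_sub (continuous_const.intervalIntegrable _ _)
    (hc.intervalIntegrable _ _), mem_K_iff.1 hκ, intervalIntegral.integral_const, smul_eq_mul,
    sub_zero, sub_self, mul_zero] at hle
  linarith

/-- Adding θ times the Ermakov bound to the energy bound leaves the surplus (1-θ)D, with θ < 1. -/
theorem lambda0_const_lt [hℓ : Fact (0 < ℓ)] {κ₀ α : ℝ} (hα : 0 < α)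
    (hlt : α * κ₀ ^ 2 < (Real.pi / ℓ) ^ 2) {κ : C(AddCircle ℓ, ℝ)} (hκ : κ ∈ K ℓ κ₀)
    (hne : κ ≠ ContinuousMap.const (AddCircle ℓ) κ₀) : α * κ₀ ^ 2 < lambda0 sqFun α κ := by
  have hℓ0 := hℓ.out
  obtain ⟨p, h, hp⟩ := exists_riccati_lambda0 sqFun α κ
  have h1 := lambda0_mul_integral_ge hα hκ h hp
  have h2 := ermakov_groundState hp
  have hN := integral_groundState_sq_pos hp
  by_contra! hcon
  -- If `p` vanished, ακ² would be the constant λ₀ ≤ ακ₀², and the mean constraint would give κ =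
  -- κ₀.
  have hpne : ∃ s : ℝ, p (s : AddCircle ℓ) * groundState p s ≠ 0 := by
    by_contra! hp0
    have hp0' : ∀ s : ℝ, p (s : AddCircle ℓ) = 0 := fun s =>
      (mul_eq_zero.1 (hp0 s)).resolve_right (groundState_pos p s).ne'
    refine hne (eq_const_of_sq_le hκ fun s => ?_)
    have hd := h s
    simp only [hp0', potential_sqFun_apply] at hd
    have := hd.unique (hasDerivAt_const s 0)
    refine le_of_mul_le_mul_left ?_ hα
    linarith
  have hD := integral_sq_pos ((continuous_coe_comp p).mul
    (continuous_of_hasDerivAt (hasDerivAt_groundState p)))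
    ((periodic_coe_comp p).mul (periodic_groundState hp)) hpne
  simp only [Pi.mul_apply] at hD
  set D := ∫ s in (0 : ℝ)..ℓ, (p (s : AddCircle ℓ) * groundState p s) ^ 2
  set N := ∫ s in (0 : ℝ)..ℓ, groundState p s ^ 2
  set I := ∫ s in (0 : ℝ)..ℓ, (groundState p s ^ 2)⁻¹
  have hk : 0 < (Real.pi / ℓ) ^ 2 := by have := Real.pi_pos; positivity
  set θ := α * κ₀ ^ 2 / (Real.pi / ℓ) ^ 2 with hθ
  have hθ0 : 0 ≤ θ := by positivity
  have hθ1 : θ < 1 := (div_lt_one hk).2 hlt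
  have hθk : θ * (Real.pi / ℓ) ^ 2 = α * κ₀ ^ 2 := div_mul_cancel₀ _ hk.ne'
  have e : α * ((ℓ * κ₀) ^ 2 / I) = θ * (Real.pi ^ 2 / I) := by
    have : α * (ℓ * κ₀) ^ 2 = θ * Real.pi ^ 2 := by
      rw [hθ]
      have := Real.pi_pos
      field_simp
    rw [← mul_div_assoc, ← mul_div_assoc, this]
  rw [e] at h1
  have h3 := mul_le_mul_of_nonneg_left h2 hθ0
  have h4 : lambda0 sqFun α κ * N ≤ α * κ₀ ^ 2 * N := mul_le_mul_of_nonneg_right hcon hN.le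
  have h5 : θ * ((Real.pi / ℓ) ^ 2 * N) = α * κ₀ ^ 2 * N := by rw [← mul_assoc, hθk]
  nlinarith

/-- The coefficient α(ℓκ₀)² of 1/I now strictly exceeds π², so the energy bound strictly beats the
Ermakov bound. -/
theorem lambda0_gt [hℓ : Fact (0 < ℓ)] {κ₀ α : ℝ}
    (hlt : (Real.pi / ℓ) ^ 2 < α * κ₀ ^ 2) {κ : C(AddCircle ℓ, ℝ)} (hκ : κ ∈ K ℓ κ₀) :
    (Real.pi / ℓ) ^ 2 < lambda0 sqFun α κ := by
  have hℓ0 := hℓ.out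
  have hα : 0 < α := pos_of_mul_pos_left (lt_of_le_of_lt (sq_nonneg _) hlt) (sq_nonneg _)
  obtain ⟨p, h, hp⟩ := exists_riccati_lambda0 sqFun α κ
  have h1 := lambda0_mul_integral_ge hα hκ h hp
  have h2 := ermakov_groundState hp
  have hI := integral_groundState_inv_sq_pos p
  refine lt_of_mul_lt_mul_right (lt_of_le_of_lt h2 (lt_of_lt_of_le ?_ h1))
    (integral_groundState_sq_pos hp).le
  refine add_lt_add_right ?_ _
  rw [← mul_div_assoc, div_lt_div_iff_of_pos_right hI]
  rw [div_pow, div_lt_iff₀ (by positivity)] at hlt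
  linarith

/-! ### Concentrating functions and the upper bound. -/

theorem integral_sin_sq_period (hℓ : 0 < ℓ) :
    ∫ s in (0 : ℝ)..ℓ, Real.sin (Real.pi / ℓ * s) ^ 2 = ℓ / 2 := by
  have hk : Real.pi / ℓ ≠ 0 := (div_pos Real.pi_pos hℓ).ne'
  rw [integral_comp_mul_left (fun x => Real.sin x ^ 2) hk, mul_zero, div_mul_cancel₀ _ hℓ.ne',
    integral_sin_sq]
  have := Real.pi_pos
  simp
  field_simp

theorem integral_cos_sq_period (hℓ : 0 < ℓ) :
    ∫ s in (0 : ℝ)..ℓ, Real.cos (Real.pi / ℓ * s) ^ 2 = ℓ / 2 := by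
  have hk : Real.pi / ℓ ≠ 0 := (div_pos Real.pi_pos hℓ).ne'
  rw [integral_comp_mul_left (fun x => Real.cos x ^ 2) hk, mul_zero, div_mul_cancel₀ _ hℓ.ne',
    integral_cos_sq]
  have := Real.pi_pos
  simp
  field_simp

/-- The profile `1 / (sin² (π s / ℓ) + δ²)`, concentrating at the origin as `δ → 0`. -/
def peak (ℓ δ s : ℝ) : ℝ := (Real.sin (Real.pi / ℓ * s) ^ 2 + δ ^ 2)⁻¹

theorem continuous_peak {δ : ℝ} (hδ : 0 < δ) : Continuous (peak ℓ δ) :=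
  Continuous.inv₀ (by fun_prop) fun s => by positivity

theorem periodic_peak (hℓ : 0 < ℓ) (δ : ℝ) : Function.Periodic (peak ℓ δ) ℓ := fun s => by
  simp only [peak, mul_add, div_mul_cancel₀ _ hℓ.ne', Real.sin_add_pi, neg_sq]

theorem peak_pos {δ : ℝ} (hδ : 0 < δ) (s : ℝ) : 0 < peak ℓ δ s := by
  unfold peak; positivity

/-- On [0, ℓδ/π] one has sin² ≤ δ², so the profile is at least 1/(2δ²) there; δ ≤ π keeps this
interval inside one period. -/
theorem integral_peak_ge (hℓ : 0 < ℓ) {δ : ℝ} (hδ : 0 < δ) (hδ' : δ ≤ Real.pi) :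
    ℓ / (2 * Real.pi * δ) ≤ ∫ s in (0 : ℝ)..ℓ, peak ℓ δ s := by
  have hπ := Real.pi_pos
  have hc := continuous_peak (ℓ := ℓ) hδ
  have hb0 : 0 ≤ ℓ * δ / Real.pi := by positivity
  have hbℓ : ℓ * δ / Real.pi ≤ ℓ := by
    rw [div_le_iff₀ hπ]; exact mul_le_mul_of_nonneg_left hδ' hℓ.le
  have h1 : ∫ _ in (0 : ℝ)..ℓ * δ / Real.pi, (2 * δ ^ 2)⁻¹
      ≤ ∫ s in (0 : ℝ)..ℓ * δ / Real.pi, peak ℓ δ s := by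
    refine integral_mono_on hb0 (continuous_const.intervalIntegrable _ _)
      (hc.intervalIntegrable _ _) fun s hs => ?_
    refine inv_anti₀ (by positivity) ?_
    have hx0 : 0 ≤ Real.pi / ℓ * s := mul_nonneg (by positivity) hs.1
    have hx : Real.pi / ℓ * s ≤ δ := by
      have := mul_le_mul_of_nonneg_left hs.2 (by positivity : 0 ≤ Real.pi / ℓ)
      refine this.trans (le_of_eq ?_)
      field_simp
    have : Real.sin (Real.pi / ℓ * s) ^ 2 ≤ (Real.pi / ℓ * s) ^ 2 := Real.sin_sq_le_sq
    nlinarith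
  have h2 : 0 ≤ ∫ s in ℓ * δ / Real.pi..ℓ, peak ℓ δ s :=
    integral_nonneg hbℓ fun s _ => (peak_pos hδ s).le
  rw [← integral_add_adjacent_intervals (hc.intervalIntegrable 0 (ℓ * δ / Real.pi))
    (hc.intervalIntegrable _ _)]
  rw [intervalIntegral.integral_const, smul_eq_mul] at h1
  refine le_trans (le_of_eq ?_) (h1.trans (le_add_of_nonneg_right h2))
  field_simp
  ring

/-- Take κ proportional to the peak and test with sin(πs/ℓ). Since peak · sin² ≤ 1, the potential
energy is at most α(ℓκ₀)²/J, where J is the mass of the peak, of order at least 1/δ. -/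
theorem exists_lambda0_le [hℓ : Fact (0 < ℓ)] {κ₀ α δ : ℝ} (hα : 0 < α) (hδ : 0 < δ)
    (hδ' : δ ≤ Real.pi) :
    ∃ κ ∈ K ℓ κ₀, lambda0 sqFun α κ ≤ (Real.pi / ℓ) ^ 2 + 4 * Real.pi * α * κ₀ ^ 2 * δ := by
  have hℓ0 := hℓ.out
  have hπ := Real.pi_pos
  have hc := continuous_peak (ℓ := ℓ) hδ
  set J := ∫ s in (0 : ℝ)..ℓ, peak ℓ δ s with hJ
  have hJge : ℓ / (2 * Real.pi * δ) ≤ J := integral_peak_ge hℓ0 hδ hδ'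
  have hJ0 : 0 < J := lt_of_lt_of_le (by positivity) hJge
  let κ : C(AddCircle ℓ, ℝ) := (ℓ * κ₀ / J) • circleLift (peak ℓ δ) hc (periodic_peak hℓ0 δ)
  have hκs : ∀ s : ℝ, κ (s : AddCircle ℓ) = ℓ * κ₀ / J * peak ℓ δ s := fun s => rfl
  refine ⟨κ, mem_K_iff.2 ?_, ?_⟩
  · simp only [hκs]
    rw [intervalIntegral.integral_const_mul, ← hJ, div_mul_cancel₀ _ hJ0.ne']
  · obtain ⟨p, h, -⟩ := exists_riccati_lambda0 sqFun α κ
    have hf : ∀ s, HasDerivAt (fun s => Real.sin (Real.pi / ℓ * s))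
        (Real.pi / ℓ * Real.cos (Real.pi / ℓ * s)) s := fun s => by
      refine (((hasDerivAt_id s).const_mul (Real.pi / ℓ)).sin).congr_deriv ?_
      simp only [id]
      ring
    have hr := h.rayleigh hf (by fun_prop) (by simp [div_mul_cancel₀ _ hℓ0.ne'])
    simp only [mul_pow] at hr
    rw [intervalIntegral.integral_const_mul, integral_sin_sq_period hℓ0,
      integral_cos_sq_period hℓ0] at hr
    have hV : ∫ s in (0 : ℝ)..ℓ, potential sqFun α κ (s : AddCircle ℓ)
        * Real.sin (Real.pi / ℓ * s) ^ 2 ≤ α * (ℓ * κ₀ / J) ^ 2 * J := by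
      rw [hJ, ← intervalIntegral.integral_const_mul, ← hJ]
      refine integral_mono_on hℓ0.le (Continuous.intervalIntegrable
        ((continuous_coe_comp _).mul (by fun_prop)) _ _)
        (Continuous.intervalIntegrable (by fun_prop) _ _) fun s _ => ?_
      rw [potential_sqFun_apply, hκs]
      have hq : peak ℓ δ s * Real.sin (Real.pi / ℓ * s) ^ 2 ≤ 1 := by
        rw [peak, inv_mul_le_one₀ (by positivity)]
        linarith [sq_nonneg δ]
      have hw : 0 ≤ α * (ℓ * κ₀ / J) ^ 2 * peak ℓ δ s :=
        mul_nonneg (by positivity) (peak_pos hδ s).le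
      have := mul_le_mul_of_nonneg_left hq hw
      linarith
    have hJ' : α * (ℓ * κ₀ / J) ^ 2 * J ≤ α * κ₀ ^ 2 * ℓ * (2 * Real.pi * δ) := by
      have e : α * (ℓ * κ₀ / J) ^ 2 * J = α * κ₀ ^ 2 * ℓ * (ℓ / J) := by field_simp
      rw [e]
      refine mul_le_mul_of_nonneg_left ?_ (by positivity)
      rw [div_le_iff₀ (by positivity)] at hJge
      rw [div_le_iff₀ hJ0]
      linarith
    have hfin : lambda0 sqFun α κ * (ℓ / 2)
        ≤ ((Real.pi / ℓ) ^ 2 + 4 * Real.pi * α * κ₀ ^ 2 * δ) * (ℓ / 2) := by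
      linarith
    exact le_of_mul_le_mul_right hfin (by positivity)

theorem isGLB_lambda0 [hℓ : Fact (0 < ℓ)] {κ₀ α : ℝ} (hlt : (Real.pi / ℓ) ^ 2 < α * κ₀ ^ 2) :
    IsGLB (lambda0 sqFun α '' K ℓ κ₀) ((Real.pi / ℓ) ^ 2) := by
  have hα : 0 < α := pos_of_mul_pos_left (lt_of_le_of_lt (sq_nonneg _) hlt) (sq_nonneg _)
  refine ⟨?_, fun b hb => ?_⟩
  · rintro _ ⟨κ, hκ, rfl⟩
    exact (lambda0_gt hlt hκ).le
  · have ht : Tendsto (fun δ : ℝ => (Real.pi / ℓ) ^ 2 + 4 * Real.pi * α * κ₀ ^ 2 * δ) (𝓝[>] 0)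
        (𝓝 ((Real.pi / ℓ) ^ 2 + 4 * Real.pi * α * κ₀ ^ 2 * 0)) :=
      (Continuous.tendsto (by fun_prop) _).mono_left nhdsWithin_le_nhds
    rw [mul_zero, add_zero] at ht
    refine ge_of_tendsto ht ?_
    filter_upwards [Ioc_mem_nhdsGT Real.pi_pos] with δ hδ
    obtain ⟨κ, hκ, hle⟩ := exists_lambda0_le (ℓ := ℓ) (κ₀ := κ₀) hα hδ.1 hδ.2
    exact (hb (mem_image_of_mem _ hκ)).trans hle

theorem alphaStar_sqFun (κ₀ : ℝ) (hκ₀ : κ₀ ≠ 0) :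
    alphaStar ℓ sqFun κ₀ = mu1 ℓ / (4 * κ₀ ^ 2) := by
  have h1 : deriv (sqFun : ℝ → ℝ) = fun x => 2 * x := by
    funext x
    change deriv (fun x : ℝ => x ^ 2) x = 2 * x
    simp
  have h2 : iteratedDeriv 2 (sqFun : ℝ → ℝ) κ₀ = 2 := by
    rw [iteratedDeriv_succ, iteratedDeriv_one, h1]
    simp
  rw [alphaStar, h2, h1]
  field_simp
  norm_num

end CircleSchrodinger

end

/-! ### The main theorem. -/

open CircleSchrodinger in
theorem theorem2 (ℓ : ℝ) [Fact (0 < ℓ)] (κ₀ : ℝ) (hκ₀ : κ₀ ≠ 0) :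
    -- `μ₁` and the principal eigenvalues are genuine (least) eigenvalues
    IsLeast (positiveLaplaceEigenvalues ℓ) (mu1 ℓ) ∧
    (∀ α : ℝ, 0 < α → ∀ κ : C(AddCircle ℓ, ℝ),
      IsLeast {lam | IsEigenvalue ℓ (potential sqFun α κ) lam} (lambda0 sqFun α κ)) ∧
    -- the critical value is `α* = μ₁ / (4 κ₀²)`
    alphaStar ℓ sqFun κ₀ = mu1 ℓ / (4 * κ₀ ^ 2) ∧
    (∀ αc : ℝ, IsCriticalValue ℓ sqFun κ₀ αc ↔ αc = alphaStar ℓ sqFun κ₀) ∧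
    -- below it the constant is the unique global minimizer
    (∀ α : ℝ, 0 < α → α < alphaStar ℓ sqFun κ₀ → ∀ κ ∈ K ℓ κ₀,
      κ ≠ ContinuousMap.const (AddCircle ℓ) κ₀ →
        lambda0 sqFun α (ContinuousMap.const (AddCircle ℓ) κ₀) < lambda0 sqFun α κ) ∧
    -- above it the infimum is `μ₁ / 4` and is not attained
    (∀ α : ℝ, alphaStar ℓ sqFun κ₀ < α →
      IsGLB (lambda0 sqFun α '' K ℓ κ₀) (Lambda0 ℓ sqFun κ₀ α) ∧
      Lambda0 ℓ sqFun κ₀ α = mu1 ℓ / 4 ∧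
      ¬ ∃ κ ∈ K ℓ κ₀, lambda0 sqFun α κ = Lambda0 ℓ sqFun κ₀ α) := by
  have hℓ0 : 0 < ℓ := Fact.out
  have hμ : mu1 ℓ / 4 = (Real.pi / ℓ) ^ 2 := by rw [mu1_eq]; ring
  have hstar := alphaStar_sqFun (ℓ := ℓ) κ₀ hκ₀
  have hκ2 : 0 < κ₀ ^ 2 := by positivity
  have hstar' : alphaStar ℓ sqFun κ₀ = (Real.pi / ℓ) ^ 2 / κ₀ ^ 2 := by
    rw [hstar, ← hμ, div_div]
  have hpos : 0 < alphaStar ℓ sqFun κ₀ := by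
    rw [hstar']
    have := Real.pi_pos
    positivity
  have hbelow : ∀ α : ℝ, 0 < α → α < alphaStar ℓ sqFun κ₀ → ∀ κ ∈ K ℓ κ₀,
      κ ≠ ContinuousMap.const (AddCircle ℓ) κ₀ →
        lambda0 sqFun α (ContinuousMap.const (AddCircle ℓ) κ₀) < lambda0 sqFun α κ :=
    fun α hα hlt κ hκ hne => by
      rw [hstar', lt_div_iff₀ hκ2] at hlt
      rw [lambda0_const]
      exact lambda0_const_lt hα hlt hκ hne
  have hmin : ∀ α, 0 < α → α < alphaStar ℓ sqFun κ₀ → ConstIsMinimizer ℓ sqFun κ₀ α :=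
    fun α hα hlt => isMinOn_iff.2 fun κ hκ => by
      by_cases hne : κ = ContinuousMap.const (AddCircle ℓ) κ₀
      · rw [hne]
      · exact (hbelow α hα hlt κ hκ hne).le
  have hnmin : ∀ α, alphaStar ℓ sqFun κ₀ < α → ¬ ConstIsMinimizer ℓ sqFun κ₀ α :=
    fun α hlt hcon => by
      rw [hstar', div_lt_iff₀ hκ2] at hlt
      -- If the constant were a minimizer, ακ₀² would be a lower bound exceeding the infimum π²/ℓ².
      refine absurd ((isGLB_lambda0 hlt).2 ?_) (not_le.2 hlt)
      rintro _ ⟨κ, hκ, rfl⟩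
      rw [← lambda0_const (ℓ := ℓ)]
      exact hcon hκ
  refine ⟨?_, fun α _ κ => ?_, hstar, fun αc => ⟨fun hc => ?_, ?_⟩, hbelow, fun α hlt => ?_⟩
  · rw [mu1_eq]
    exact isLeast_positiveLaplaceEigenvalues
  · obtain ⟨p, h, hp⟩ := exists_riccati_lambda0 sqFun α κ
    exact h.isLeast hp
  · obtain ⟨h0, h1, h2⟩ := hc
    by_contra hne
    -- An α strictly between two distinct critical values would make the constant both a minimizer
    -- and not one.
    rcases lt_or_gt_of_ne hne with hlt | hlt
    · obtain ⟨α, ha, hb⟩ := exists_between hlt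
      exact h2 α ha (hmin α (h0.trans ha) hb)
    · obtain ⟨α, ha, hb⟩ := exists_between hlt
      exact hnmin α ha (h1 α (hpos.trans ha) hb)
  · rintro rfl
    exact ⟨hpos, hmin, hnmin⟩
  · rw [hstar', div_lt_iff₀ hκ2] at hlt
    have hglb := isGLB_lambda0 hlt
    have hL : Lambda0 ℓ sqFun κ₀ α = (Real.pi / ℓ) ^ 2 :=
      hglb.csInf_eq ⟨_, mem_image_of_mem _ (const_mem_K κ₀)⟩
    refine ⟨hL ▸ hglb, hL.trans hμ.symm, ?_⟩
    rintro ⟨κ, hκ, he⟩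
    exact (lambda0_gt hlt hκ).ne' (he.trans hL)
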